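/- Let $M=\mathbb H^{n+1}/\Gamma$ be a closed hyperbolic manifold, where $\Gamma$ is a torsion-free cocompact lattice in the isometry group of real hyperbolic space $\mathbb H^{n+1}$. Let $d_M$ be the distance of $M$, $i_M$ its injectivity radius, $\pi:SM\to M$ the unit tangent bundle, $\phi^t$ the geodesic flow on $SM$, and $\gamma_v(t)=\pi(\phi^t v)$ for $v\in SM$. For $l\ge 0$ put $$d_l(v,w)=\max_{0\le t\le l} d_M(\gamma_v(t),\gamma_w(t)).$$ Fix $0<\varepsilon_0<i_M/2$, and consider increasing bijections $\varphi:(1,\infty)\to(\varepsilon_0,\infty)$. The ray $\gamma_v$ is called $\varphi$-aperiodic (with respect to $\varepsilon_0$ and the parameter $l_0=0$) if for all times $t\ge 0$, all shifts $s>\varepsilon_0$ and all lengths $l>1$, $$d_l(\phi^{t}v,\phi^{t+s}v)\le\varepsilon_0\ \Longrightarrow\ s\ge\varphi(l).$$ For a closed geodesic $\alpha$ in $M$ with length (primitive period) $|\alpha|$ and $v_\alpha=\dot\alpha(0)$, and for $v\in SM$, $t_0\ge 0$, define the penetration length $\mathfrak p_\alpha(v,t_0)\in[0,\infty]$ by $\mathfrak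 p_\alpha(v,t_0)=0$ if $d_M(\gamma_v(t_0),\alpha)>\varepsilon_0/2$, and otherwise $$\mathfrak p_\alpha(v,t_0)=\sup\{L\ge 0:\ d_L(\phi^{t_0}v,\phi^{t}v_\alpha)\le\varepsilon_0/2\ \text{for some } t\in[0,|\alpha|]\}.$$ Consider the condition $$(\ast)\qquad \mathfrak p_\alpha(v,t_0)\le|\alpha|+\varphi^{-1}(|\alpha|)\quad\text{for every closed geodesic }\alpha\text{ in }M\text{ and all }t_0\ge 0.$$ 1. For every increasing bijection $\varphi:(1,\infty)\to(\varepsilon_0,\infty)$ and every $v\in SM$: if $\gamma_v$ is $\varphi$-aperiodic (with $l_0=0$), then $(\ast)$ holds. 2. Suppose $i_M\ge 2\log(1+\sqrt2)$. Then there are constants $c_0>0$, $l_0>2c_0+2\varepsilon_0+1$ and $s_0>\varepsilon_0$, depending only on $M$ and $\varepsilon_0$, such that for every increasing bijection $\varphi:(1,\infty)\to(\varepsilon_0,\infty)$ and every $v\in SM$ satisfying $(\ast)$, we have for all times $t_0\ge 0$, all shifts $s\ge s_0$ and all lengths $l\ge l_0$ $$d_l(\phi^{t_0}v,\phi^{t_0+s}v)\le\varepsilon_0\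 \Longrightarrow\ s\ge\tilde\varphi(l),\qquad \tilde\varphi(l)=\varphi(l-2c_0-2\varepsilon_0)-\varepsilon_0.$$ -/

import Mathlib

/-!
Closed hyperbolic manifolds `M = ℍ^{n+1} / Γ`, their unit tangent bundle and geodesic flow.
Hyperbolic space is the upper sheet of the hyperboloid in `ℝ^{n+2}`, with isometry group the
linear group preserving the Lorentz form and that sheet.
-/

noncomputable section

namespace HypGeod

/-- The Lorentz form `-x₀y₀ + x₁y₁ + ⋯ + x_{n+1}y_{n+1}` on `ℝ^{n+2}`. -/
def form {n : ℕ} (x y : Fin (n + 2) → ℝ) : ℝ :=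
  -(x 0 * y 0) + ∑ i : Fin (n + 1), x i.succ * y i.succ

lemma form_comb {n : ℕ} (a b c d : ℝ) (x u y w : Fin (n + 2) → ℝ) :
    form (a • x + b • u) (c • y + d • w) =
      a * c * form x y + a * d * form x w + b * c * form u y + b * d * form u w := by
  simp only [form, Pi.add_apply, Pi.smul_apply, smul_eq_mul, mul_add, Finset.mul_sum, add_mul,
    Finset.sum_add_distrib]
  have h (p q : ℝ) (f g : Fin (n + 2) → ℝ) :
      ∑ i : Fin (n + 1), p * f i.succ * (q * g i.succ)
        = ∑ i : Fin (n + 1), p * q * (f i.succ * g i.succ) :=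
    Finset.sum_congr rfl fun _ _ => by ring
  simp only [h]
  ring

lemma form_comm {n : ℕ} (x y : Fin (n + 2) → ℝ) : form x y = form y x := by
  simp only [form, mul_comm]

/-- The upper sheet of the hyperboloid: `(n+1)`-dimensional real hyperbolic space. -/
def sheet (n : ℕ) : Set (Fin (n + 2) → ℝ) := {x | form x x = -1 ∧ 0 < x 0}

lemma sq_zero_of_form {n : ℕ} {x : Fin (n + 2) → ℝ} (h : form x x = -1) : 1 ≤ x 0 * x 0 := by
  have h' : 0 ≤ ∑ i : Fin (n + 1), x i.succ * x i.succ :=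
    Finset.sum_nonneg fun i _ => mul_self_nonneg _
  simp only [form] at h
  linarith

/-- Hyperbolic space `ℍ^{n+1}`, with the subspace topology of `ℝ^{n+2}`. -/
abbrev Hyp (n : ℕ) : Type := sheet n

/-- The hyperbolic distance. -/
def hdist {n : ℕ} (x y : Hyp n) : ℝ := Real.arcosh (-form x.1 y.1)

/-- The isometry group of `ℍ^{n+1}`: the linear maps that preserve the Lorentz form and map the
upper sheet to itself, topologized as a subgroup of `GL(n+2, ℝ)`. -/
def IsomHyp (n : ℕ) : Subgroup (GL (Fin (n + 2)) ℝ) where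
  carrier := {A | (∀ x y, form (A.1.mulVec x) (A.1.mulVec y) = form x y) ∧
    ∀ x ∈ sheet n, A.1.mulVec x ∈ sheet n}
  one_mem' := by simp
  mul_mem' := by
    rintro A B ⟨hA, hA'⟩ ⟨hB, hB'⟩
    refine ⟨fun x y => ?_, fun x hx => ?_⟩
    · simp only [Units.val_mul, ← Matrix.mulVec_mulVec, hA, hB]
    · simp only [Units.val_mul, ← Matrix.mulVec_mulVec]
      exact hA' _ (hB' _ hx)
  inv_mem' := by
    rintro A ⟨hA, hA'⟩
    have key (x : Fin (n + 2) → ℝ) : A.1.mulVec ((A⁻¹).1.mulVec x) = x := by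
      rw [Matrix.mulVec_mulVec, Units.mul_inv, Matrix.one_mulVec]
    have hf (x y) : form ((A⁻¹).1.mulVec x) ((A⁻¹).1.mulVec y) = form x y := by
      rw [← hA, key, key]
    refine ⟨hf, fun x hx => ⟨by rw [hf]; exact hx.1, ?_⟩⟩
    by_contra hneg
    have h1 : form ((A⁻¹).1.mulVec x) ((A⁻¹).1.mulVec x) = -1 := by rw [hf]; exact hx.1
    have h2 := sq_zero_of_form h1
    have h3 : -((A⁻¹).1.mulVec x) ∈ sheet n := by
      refine ⟨?_, ?_⟩
      · simpa [form] using h1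
      · simp only [Pi.neg_apply]
        nlinarith
    have h4 := (hA' _ h3).2
    rw [Matrix.mulVec_neg, key, Pi.neg_apply] at h4
    linarith [hx.2]

instance (n : ℕ) : MulAction (IsomHyp n) (Hyp n) where
  smul A x := ⟨A.1.1.mulVec x.1, A.2.2 _ x.2⟩
  one_smul x := Subtype.ext (Matrix.one_mulVec x.1)
  mul_smul A B x := Subtype.ext (Matrix.mulVec_mulVec x.1 A.1.1 B.1.1).symm

/-- The unit tangent bundle `S ℍ^{n+1}`: pairs of a point `x` of the hyperboloid and a unit vector
`u` tangent to the hyperboloid at `x`. -/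
abbrev UnitTangent (n : ℕ) : Type :=
  {v : (Fin (n + 2) → ℝ) × (Fin (n + 2) → ℝ) //
    v.1 ∈ sheet n ∧ form v.1 v.2 = 0 ∧ form v.2 v.2 = 1}

/-- Isometries act on the unit tangent bundle by their derivative. -/
instance (n : ℕ) : MulAction (IsomHyp n) (UnitTangent n) where
  smul A v := ⟨(A.1.1.mulVec v.1.1, A.1.1.mulVec v.1.2),
    A.2.2 _ v.2.1, by rw [A.2.1]; exact v.2.2.1, by rw [A.2.1]; exact v.2.2.2⟩
  one_smul v := Subtype.ext (Prod.ext (Matrix.one_mulVec v.1.1) (Matrix.one_mulVec v.1.2))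
  mul_smul A B v := Subtype.ext (Prod.ext (Matrix.mulVec_mulVec v.1.1 A.1.1 B.1.1).symm
    (Matrix.mulVec_mulVec v.1.2 A.1.1 B.1.1).symm)

/-- The footpoint projection on `S ℍ^{n+1}`. -/
def foot {n : ℕ} (v : UnitTangent n) : Hyp n := ⟨v.1.1, v.2.1⟩

/-- The unit-speed geodesic `t ↦ cosh t • x + sinh t • u` on the hyperboloid stays on the upper
sheet. -/
lemma geod_mem {n : ℕ} (t : ℝ) (v : UnitTangent n) :
    Real.cosh t • v.1.1 + Real.sinh t • v.1.2 ∈ sheet n := by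
  have hform (t : ℝ) : form (Real.cosh t • v.1.1 + Real.sinh t • v.1.2)
      (Real.cosh t • v.1.1 + Real.sinh t • v.1.2) = -1 := by
    rw [form_comb, form_comm v.1.2 v.1.1, v.2.1.1, v.2.2.1, v.2.2.2]
    linarith [Real.cosh_sq t]
  refine ⟨hform t, ?_⟩
  by_contra hneg
  have hcont : Continuous fun s : ℝ => (Real.cosh s • v.1.1 + Real.sinh s • v.1.2) 0 := by
    simp only [Pi.add_apply, Pi.smul_apply, smul_eq_mul]
    exact (Real.continuous_cosh.mul continuous_const).add
      (Real.continuous_sinh.mul continuous_const)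
  obtain ⟨s, hs⟩ := mem_range_of_exists_le_of_exists_ge (c := (0 : ℝ)) hcont ⟨t, not_lt.mp hneg⟩
    ⟨0, by simpa using v.2.1.2.le⟩
  have h := sq_zero_of_form (hform s)
  simp only at hs
  rw [hs] at h
  norm_num at h

/-- The geodesic flow on `S ℍ^{n+1}`. -/
def flow {n : ℕ} (t : ℝ) (v : UnitTangent n) : UnitTangent n :=
  ⟨(Real.cosh t • v.1.1 + Real.sinh t • v.1.2, Real.sinh t • v.1.1 + Real.cosh t • v.1.2),
    geod_mem t v, by
      rw [form_comb, form_comm v.1.2 v.1.1, v.2.1.1, v.2.2.1, v.2.2.2]; ring, by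
      rw [form_comb, form_comm v.1.2 v.1.1, v.2.1.1, v.2.2.1, v.2.2.2]
      linarith [Real.cosh_sq t]⟩

lemma flow_smul {n : ℕ} (t : ℝ) (A : IsomHyp n) (v : UnitTangent n) :
    flow t (A • v) = A • flow t v := by
  have h (a b : ℝ) : a • A.1.1.mulVec v.1.1 + b • A.1.1.mulVec v.1.2
      = A.1.1.mulVec (a • v.1.1 + b • v.1.2) := by
    rw [Matrix.mulVec_add, Matrix.mulVec_smul, Matrix.mulVec_smul]
  exact Subtype.ext (Prod.ext (h _ _) (h _ _))

variable {n : ℕ}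

/-- `Γ` is a torsion-free cocompact lattice in the isometry group of `ℍ^{n+1}`, so that
`ℍ^{n+1} / Γ` is a closed hyperbolic manifold. -/
structure IsTorsionFreeCocompactLattice (Γ : Subgroup (IsomHyp n)) : Prop where
  discrete : DiscreteTopology Γ
  torsionFree : ∀ g : Γ, IsOfFinOrder g → g = 1
  cocompact : CompactSpace (MulAction.orbitRel.Quotient Γ (Hyp n))

/-- The manifold `M = ℍ^{n+1} / Γ`. -/
abbrev Mfd (Γ : Subgroup (IsomHyp n)) : Type := MulAction.orbitRel.Quotient Γ (Hyp n)

/-- The unit tangent bundle `SM = S ℍ^{n+1} / Γ`. -/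
abbrev SMfd (Γ : Subgroup (IsomHyp n)) : Type := MulAction.orbitRel.Quotient Γ (UnitTangent n)

/-- The distance on `M`: the distance between the two fibres in `ℍ^{n+1}`. -/
def mdist {Γ : Subgroup (IsomHyp n)} (p q : Mfd Γ) : ℝ :=
  sInf {r | ∃ x y : Hyp n, Quotient.mk _ x = p ∧ Quotient.mk _ y = q ∧ hdist x y = r}

/-- The footpoint projection `π : SM → M`. -/
def proj {Γ : Subgroup (IsomHyp n)} : SMfd Γ → Mfd Γ :=
  Quotient.map foot (by
    rintro _ v ⟨g, rfl⟩
    exact ⟨g, rfl⟩)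

/-- The geodesic flow `φ^t : SM → SM`. -/
def geodFlow {Γ : Subgroup (IsomHyp n)} (t : ℝ) : SMfd Γ → SMfd Γ :=
  Quotient.map (flow t) (by
    rintro _ v ⟨g, rfl⟩
    exact ⟨g, (flow_smul t g.1 v).symm⟩)

/-- The geodesic `γ_v(t) = π(φ^t v)` in `M`. -/
def geod {Γ : Subgroup (IsomHyp n)} (v : SMfd Γ) (t : ℝ) : Mfd Γ := proj (geodFlow t v)

/-- The injectivity radius `i_M`: the supremum of the `r` such that at every point `p` of `M` the
exponential map `t v ↦ γ_v(t)` is injective on the open ball of radius `r` of the tangent space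
at `p`, whose elements are written as `t v` with `0 ≤ t < r` and `v` a unit vector at `p`. -/
def injRadius (Γ : Subgroup (IsomHyp n)) : ℝ :=
  sSup {r : ℝ | ∀ v w : SMfd Γ, proj v = proj w →
    ∀ t t' : ℝ, 0 ≤ t → t < r → 0 ≤ t' → t' < r → geod v t = geod w t' →
      t = t' ∧ (t = 0 ∨ v = w)}

/-- `d_l(v, w) = max_{0 ≤ t ≤ l} d_M(γ_v(t), γ_w(t))`. -/
def bowenDist {Γ : Subgroup (IsomHyp n)} (l : ℝ) (v w : SMfd Γ) : ℝ :=
  ⨆ t : Set.Icc (0 : ℝ) l, mdist (geod v t) (geod w t)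

/-- The ray `γ_v` is `φ`-aperiodic with respect to the parameters `ε₀` and `l₀`, for a function
`φ` defined on `(1, ∞)`. -/
def IsAperiodicRay {Γ : Subgroup (IsomHyp n)} (ε₀ l₀ : ℝ) (φ : ℝ → ℝ) (v : SMfd Γ) : Prop :=
  ∀ t s l : ℝ, 0 ≤ t → ε₀ < s → l₀ ≤ l → 1 < l →
    bowenDist l (geodFlow t v) (geodFlow (t + s) v) ≤ ε₀ → φ l ≤ s

/-- `γ_w` is a closed geodesic of length `ℓ`: the vector `w` is periodic under the geodesic flow
with primitive period `ℓ`. -/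
def IsClosedGeodesic {Γ : Subgroup (IsomHyp n)} (w : SMfd Γ) (ℓ : ℝ) : Prop :=
  IsLeast {p : ℝ | 0 < p ∧ geodFlow p w = w} ℓ

open Classical in
/-- The penetration length `𝔭_α(v, t₀) ∈ [0, ∞]` of `γ_v` at time `t₀` in the neighbourhood of the
closed geodesic `α = γ_w` of length `ℓ`. -/
def penetration {Γ : Subgroup (IsomHyp n)} (ε₀ : ℝ) (w : SMfd Γ) (ℓ : ℝ) (v : SMfd Γ)
    (t₀ : ℝ) : ENNReal :=
  if ε₀ / 2 < ⨅ t : ℝ, mdist (geod v t₀) (geod w t) then 0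
  else sSup {a | ∃ L : ℝ, 0 ≤ L ∧ a = ENNReal.ofReal L ∧
    ∃ t ∈ Set.Icc (0 : ℝ) ℓ, bowenDist L (geodFlow t₀ v) (geodFlow t w) ≤ ε₀ / 2}

/-- The set `Bounded_α(L)` for the closed geodesic `α = γ_w` of length `ℓ`. -/
def Bounded {Γ : Subgroup (IsomHyp n)} (ε₀ : ℝ) (w : SMfd Γ) (ℓ L : ℝ) : Set (SMfd Γ) :=
  {v | ∀ t₀ : ℝ, 0 ≤ t₀ → penetration ε₀ w ℓ v t₀ ≤ ENNReal.ofReal L}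

/-- `v` lies in `Bounded_α(|α| + φ⁻¹(|α|))` for every closed geodesic `α` in `M`, where `φ⁻¹` is
the inverse of `φ` on `(1, ∞)`. -/
def BoundedForAll {Γ : Subgroup (IsomHyp n)} (ε₀ : ℝ) (φ : ℝ → ℝ) (v : SMfd Γ) : Prop :=
  ∀ (w : SMfd Γ) (ℓ : ℝ), IsClosedGeodesic w ℓ →
    v ∈ Bounded ε₀ w ℓ (ℓ + Function.invFunOn φ (Set.Ioi 1) ℓ)

end HypGeod

end

noncomputable section

namespace HypGeod

open Real

variable {n : ℕ}

/-! ### The Lorentz form -/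

/-! Statement 1: if `γ_v` stays within `ε₀/2` of a closed geodesic `α` for longer than `|α| +
φ⁻¹(|α|)`, then comparing times differing by one period of `α` gives a self-approach of shift `|α|`
and length greater than `φ⁻¹(|α|)`. Since `φ` is strictly increasing, this contradicts aperiodicity
(`boundedForAll_of_isAperiodicRay`).

Statement 2 rests on `exists_closedGeodesic_follow`: a self-approach of shift `s` and length `l`
forces `γ_v` to follow a closed geodesic of length `ℓ ≤ s + ε₀` for time at least `s + l - 2c₀`.
Then `(∗)` gives `φ⁻¹(ℓ) ≥ l - 2c₀ - ε₀`, and applying `φ` bounds `s` from below. To find this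
closed geodesic, lift to hyperbolic space. Because `ε₀ < i_M/2`, a single lattice element `η`
matches the two strands on the whole time interval (`exists_matching_element`). It is nontrivial, so
by cocompactness it translates an axis (`exists_axis`). The endpoints of the axis are null vectors
that `η` scales by `e^{±p}`, where `p` is the translation length. Pairing them with the lifted
geodesic gives two functions of the form `a e^t + b e^{-t}`. Since `η` nearly acts as the time shift
`s`, the coefficient growing towards the forward endpoint and the one decaying away from the
backward endpoint dominate (`dominant_coefficients`). A Gram inequality then bounds the distance to
the axis away from the ends of `[0, s + l]` (`exists_shift_close`). -/

lemma form_add_left (x y z : Fin (n + 2) → ℝ) : form (x + y) z = form x z + form y z := by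
  simpa using form_comb 1 1 1 0 x y z 0

lemma form_smul_left (a : ℝ) (x z : Fin (n + 2) → ℝ) : form (a • x) z = a * form x z := by
  simpa using form_comb a 0 1 0 x 0 z 0

lemma form_add_right (x y z : Fin (n + 2) → ℝ) : form z (x + y) = form z x + form z y := by
  simp only [form_comm z, form_add_left]

lemma form_smul_right (a : ℝ) (x z : Fin (n + 2) → ℝ) : form z (a • x) = a * form z x := by
  simp only [form_comm z, form_smul_left]

lemma form_sub_left (x y z : Fin (n + 2) → ℝ) : form (x - y) z = form x z - form y z := by
  simpa [sub_eq_add_neg] using form_comb 1 (-1) 1 0 x y z 0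

lemma form_sub_right (x y z : Fin (n + 2) → ℝ) : form z (x - y) = form z x - form z y := by
  simp only [form_comm z, form_sub_left]

lemma continuous_form {X : Type*} [TopologicalSpace X] {f g : X → Fin (n + 2) → ℝ}
    (hf : Continuous f) (hg : Continuous g) : Continuous fun x => form (f x) (g x) := by
  unfold form
  fun_prop

/-- The Cauchy–Schwarz inequality for the spatial parts of two Lorentz-orthogonal vectors, one of
which is timelike and normalized. -/
lemma time_sq_mul_le {y z : Fin (n + 2) → ℝ} (hy : form y y = -1) (hyz : form y z = 0) :
    y 0 ^ 2 * z 0 ^ 2 ≤ (y 0 ^ 2 - 1) * ∑ i : Fin (n + 1), z i.succ ^ 2 := by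
  have hcs := Finset.sum_mul_sq_le_sq_mul_sq Finset.univ
    (fun i : Fin (n + 1) => y i.succ) (fun i => z i.succ)
  simp only [form, ← pow_two] at hy hyz
  have h1 : ∑ i : Fin (n + 1), y i.succ * z i.succ = y 0 * z 0 := by linarith
  have h2 : ∑ i : Fin (n + 1), y i.succ ^ 2 = y 0 ^ 2 - 1 := by linarith
  rwa [h1, h2, mul_pow] at hcs

/-- As `y 0 ^ 2 ≥ 1`, the bound `time_sq_mul_le` lets the spatial part of `z` dominate its time
part. This positivity underlies every Cauchy–Schwarz argument below. -/
lemma form_self_nonneg {y z : Fin (n + 2) → ℝ} (hy : form y y = -1) (hyz : form y z = 0) :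
    0 ≤ form z z := by
  have h := time_sq_mul_le hy hyz
  have h1 := sq_zero_of_form hy
  have hS : 0 ≤ ∑ i : Fin (n + 1), z i.succ ^ 2 := Finset.sum_nonneg fun i _ => sq_nonneg _
  simp only [form, ← pow_two]
  by_contra hneg
  nlinarith [sq_nonneg (z 0)]

lemma eq_zero_of_form_self {y z : Fin (n + 2) → ℝ} (hy : form y y = -1) (hyz : form y z = 0)
    (hz : form z z ≤ 0) : z = 0 := by
  have h := time_sq_mul_le hy hyz
  have h1 := sq_zero_of_form hy
  have hS : ∀ i ∈ (Finset.univ : Finset (Fin (n + 1))), 0 ≤ z i.succ ^ 2 := fun i _ => sq_nonneg _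
  simp only [form, ← pow_two] at hz
  have h0 : z 0 ^ 2 = 0 := by nlinarith [sq_nonneg (z 0)]
  have hs : ∑ i : Fin (n + 1), z i.succ ^ 2 = 0 :=
    le_antisymm (by linarith) (Finset.sum_nonneg hS)
  rw [Finset.sum_eq_zero_iff_of_nonneg hS] at hs
  funext i
  refine Fin.cases ?_ (fun j => ?_) i
  · simpa using h0
  · simpa using hs j (Finset.mem_univ j)

/-- The Cauchy–Schwarz inequality on the orthogonal complement of a timelike vector. -/
lemma form_sq_le {y z w : Fin (n + 2) → ℝ} (hy : form y y = -1) (hyz : form y z = 0)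
    (hyw : form y w = 0) : form z w ^ 2 ≤ form z z * form w w := by
  have h : ∀ t : ℝ, 0 ≤ form z z * (t * t) + (2 * form z w) * t + form w w := by
    intro t
    have := form_self_nonneg (z := t • z + w) hy
      (by rw [form_add_right, form_smul_right, hyz, hyw]; ring)
    simp only [form_add_left, form_add_right, form_smul_left, form_smul_right,
      form_comm w z] at this
    linarith
  have := discrim_le_zero h
  rw [discrim] at this
  linarith

lemma abs_form_le {y z w : Fin (n + 2) → ℝ} (hy : form y y = -1) (hyz : form y z = 0)
    (hyw : form y w = 0) {a b : ℝ} (ha : 0 ≤ a) (hb : 0 ≤ b) (hz : form z z = a ^ 2)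
    (hw : form w w = b ^ 2) : |form z w| ≤ a * b := by
  have h := form_sq_le hy hyz hyw
  rw [hz, hw, ← mul_pow] at h
  exact abs_le_of_sq_le_sq h (mul_nonneg ha hb)

/-! ### Hyperbolic distance -/

/-- The component of `y` orthogonal to `x` has nonnegative square, which gives `form x y ^ 2 ≥ 1`.
The sign comes from Euclidean Cauchy–Schwarz on the spatial parts and positivity of the time
coordinates. -/
lemma form_le_neg_one (x y : Hyp n) : form x.1 y.1 ≤ -1 := by
  obtain ⟨x, hx, hx0⟩ := x
  obtain ⟨y, hy, hy0⟩ := y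
  have h1 := sq_zero_of_form hx
  have h2 := sq_zero_of_form hy
  have hz := form_self_nonneg (z := y + form x y • x) hx
    (by rw [form_add_right, form_smul_right, hx]; ring)
  simp only [form_add_left, form_add_right, form_smul_left, form_smul_right,
    form_comm y x, hx, hy] at hz
  have hcs := Finset.sum_mul_sq_le_sq_mul_sq Finset.univ
    (fun i : Fin (n + 1) => x i.succ) (fun i => y i.succ)
  have hneg : form x y < 0 := by
    simp only [form, ← pow_two] at hx hy ⊢
    have e1 : ∑ i : Fin (n + 1), x i.succ ^ 2 = x 0 ^ 2 - 1 := by linarith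
    have e2 : ∑ i : Fin (n + 1), y i.succ ^ 2 = y 0 ^ 2 - 1 := by linarith
    rw [e1, e2] at hcs
    have : ∑ i : Fin (n + 1), x i.succ * y i.succ < x 0 * y 0 := by
      apply lt_of_pow_lt_pow_left₀ 2 (by positivity)
      nlinarith
    linarith
  change form x y ≤ -1
  nlinarith

lemma cosh_hdist (x y : Hyp n) : cosh (hdist x y) = -form x.1 y.1 :=
  cosh_arcosh (by linarith [form_le_neg_one x y])

lemma hdist_nonneg (x y : Hyp n) : 0 ≤ hdist x y :=
  arcosh_nonneg (by linarith [form_le_neg_one x y])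

lemma hdist_comm (x y : Hyp n) : hdist x y = hdist y x := by
  rw [hdist, form_comm, hdist]

lemma hdist_le_iff {x y : Hyp n} {r : ℝ} (hr : 0 ≤ r) :
    hdist x y ≤ r ↔ -form x.1 y.1 ≤ cosh r := by
  rw [← cosh_hdist, cosh_le_cosh, abs_of_nonneg (hdist_nonneg x y), abs_of_nonneg hr]

lemma hdist_smul (A : IsomHyp n) (x y : Hyp n) : hdist (A • x) (A • y) = hdist x y := by
  change arcosh (-form (A.1.1.mulVec x.1) (A.1.1.mulVec y.1)) = _
  rw [A.2.1]
  rfl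

lemma continuous_hdist {X : Type*} [TopologicalSpace X] {f g : X → Hyp n}
    (hf : Continuous f) (hg : Continuous g) : Continuous fun x => hdist (f x) (g x) :=
  continuousOn_arcosh.comp_continuous
    (continuous_form (continuous_subtype_val.comp hf) (continuous_subtype_val.comp hg)).neg
    fun x => by simpa using le_neg_of_le_neg (form_le_neg_one (f x) (g x))

lemma flow_val_fst (t : ℝ) (v : UnitTangent n) :
    (flow t v).1.1 = cosh t • v.1.1 + sinh t • v.1.2 := rfl

lemma flow_val_snd (t : ℝ) (v : UnitTangent n) :
    (flow t v).1.2 = sinh t • v.1.1 + cosh t • v.1.2 := rfl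

lemma flow_zero (v : UnitTangent n) : flow 0 v = v := by
  apply Subtype.ext
  apply Prod.ext <;> simp [flow]

lemma flow_flow (s t : ℝ) (v : UnitTangent n) : flow s (flow t v) = flow (s + t) v := by
  apply Subtype.ext
  apply Prod.ext
  · simp only [flow_val_fst, flow_val_snd, cosh_add, sinh_add]
    module
  · simp only [flow_val_fst, flow_val_snd, cosh_add, sinh_add]
    module

lemma hdist_foot_flow (v : UnitTangent n) (t : ℝ) : hdist (foot v) (foot (flow t v)) = |t| := by
  have h : cosh (hdist (foot v) (foot (flow t v))) = cosh |t| := by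
    rw [cosh_hdist, cosh_abs]
    change -form v.1.1 (cosh t • v.1.1 + sinh t • v.1.2) = _
    rw [form_add_right, form_smul_right, form_smul_right, v.2.1.1, v.2.2.1]
    ring
  exact cosh_injOn (hdist_nonneg _ _) (abs_nonneg t) h

lemma hdist_flow_flow (v : UnitTangent n) (s t : ℝ) :
    hdist (foot (flow s v)) (foot (flow t v)) = |t - s| := by
  rw [← hdist_foot_flow (flow s v) (t - s), flow_flow, sub_add_cancel]

lemma eq_of_hdist_eq_zero {x y : Hyp n} (h : hdist x y = 0) : x = y := by
  have hxy : form x.1 y.1 = -1 := by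
    have := cosh_hdist x y
    rw [h, cosh_zero] at this
    linarith
  apply Subtype.ext
  rw [← sub_eq_zero]
  apply eq_zero_of_form_self x.2.1
  · rw [form_sub_right, hxy, x.2.1]; ring
  · simp only [form_sub_left, form_sub_right, form_comm y.1 x.1, hxy, x.2.1, y.2.1]; norm_num

/-- The unit vector at `x` pointing to `y`. -/
lemma exists_direction {x y : Hyp n} (h : x ≠ y) :
    ∃ v : UnitTangent n, foot v = x ∧ foot (flow (hdist x y) v) = y := by
  have hd : 0 < hdist x y :=
    lt_of_le_of_ne (hdist_nonneg x y) fun h0 => h (eq_of_hdist_eq_zero h0.symm)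
  have hs : sinh (hdist x y) ≠ 0 := (sinh_pos_iff.2 hd).ne'
  have hxy : form x.1 y.1 = -cosh (hdist x y) := by rw [cosh_hdist]; ring
  have hsq := cosh_sq (hdist x y)
  refine ⟨⟨(x.1, (sinh (hdist x y))⁻¹ • (y.1 - cosh (hdist x y) • x.1)), x.2, ?_, ?_⟩, rfl, ?_⟩
  · simp only [form_smul_right, form_sub_right, hxy, x.2.1]
    ring
  · simp only [form_smul_right, form_sub_right, form_smul_left, form_sub_left,
      form_comm y.1 x.1, hxy, x.2.1, y.2.1]
    field_simp
    linarith
  · apply Subtype.ext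
    change cosh (hdist x y) • x.1 + sinh (hdist x y) •
      ((sinh (hdist x y))⁻¹ • (y.1 - cosh (hdist x y) • x.1)) = y.1
    rw [smul_inv_smul₀ hs]
    module

/-- Law of cosines at `y`: the components of `x` and `z` orthogonal to `y` have lengths `sinh (hdist
x y)` and `sinh (hdist y z)`, so Cauchy–Schwarz and the addition formula for `cosh` suffice. -/
lemma hdist_triangle (x y z : Hyp n) : hdist x z ≤ hdist x y + hdist y z := by
  rw [hdist_le_iff (add_nonneg (hdist_nonneg _ _) (hdist_nonneg _ _)), cosh_add]
  have hxy : form y.1 x.1 = -cosh (hdist x y) := by rw [cosh_hdist, form_comm]; ring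
  have hyz : form y.1 z.1 = -cosh (hdist y z) := by rw [cosh_hdist]; ring
  have h1 := cosh_sq (hdist x y)
  have h2 := cosh_sq (hdist y z)
  have h := abs_form_le (z := x.1 - cosh (hdist x y) • y.1) (w := z.1 - cosh (hdist y z) • y.1)
    (a := sinh (hdist x y)) (b := sinh (hdist y z)) y.2.1
    (by rw [form_sub_right, form_smul_right, y.2.1, hxy]; ring)
    (by rw [form_sub_right, form_smul_right, y.2.1, hyz]; ring)
    (sinh_nonneg_iff.2 (hdist_nonneg _ _)) (sinh_nonneg_iff.2 (hdist_nonneg _ _))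
    (by simp only [form_smul_right, form_sub_right, form_smul_left, form_sub_left,
          form_comm x.1 y.1, hxy, x.2.1, y.2.1]
        linarith)
    (by simp only [form_smul_right, form_sub_right, form_smul_left, form_sub_left,
          form_comm z.1 y.1, hyz, z.2.1, y.2.1]
        linarith)
  have h' := neg_abs_le (form (x.1 - cosh (hdist x y) • y.1) (z.1 - cosh (hdist y z) • y.1))
  have e : form (x.1 - cosh (hdist x y) • y.1) (z.1 - cosh (hdist y z) • y.1) =
      form x.1 z.1 + cosh (hdist x y) * cosh (hdist y z) := by
    simp only [form_smul_right, form_sub_right, form_smul_left, form_sub_left,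
      form_comm x.1 y.1, hxy, hyz, y.2.1]
    ring
  linarith

/-! ### Null vectors -/

/-- Two null vectors in the closed future cone pair nonpositively. -/
lemma form_null_null_nonpos {ξ ζ : Fin (n + 2) → ℝ} (hξ : form ξ ξ = 0) (hζ : form ζ ζ = 0)
    (y : Hyp n) (h1 : form y.1 ξ ≤ 0) (h2 : form y.1 ζ ≤ 0) : form ξ ζ ≤ 0 := by
  have h := abs_form_le (z := ξ + form y.1 ξ • y.1) (w := ζ + form y.1 ζ • y.1)
    (a := -form y.1 ξ) (b := -form y.1 ζ) y.2.1
    (by rw [form_add_right, form_smul_right, y.2.1]; ring)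
    (by rw [form_add_right, form_smul_right, y.2.1]; ring)
    (by linarith) (by linarith)
    (by simp only [form_smul_right, form_add_right, form_smul_left, form_add_left,
          form_comm ξ y.1, y.2.1, hξ]
        ring)
    (by simp only [form_smul_right, form_add_right, form_smul_left, form_add_left,
          form_comm ζ y.1, y.2.1, hζ]
        ring)
  have h' := le_abs_self (form (ξ + form y.1 ξ • y.1) (ζ + form y.1 ζ • y.1))
  have e : form (ξ + form y.1 ξ • y.1) (ζ + form y.1 ζ • y.1) =
      form ξ ζ + form y.1 ξ * form y.1 ζ := by
    simp only [form_smul_right, form_add_right, form_smul_left, form_add_left,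
      form_comm ξ y.1, y.2.1]
    ring
  linarith

/-- Busemann functions are `1`-Lipschitz, multiplicative form. -/
lemma neg_form_null_bounds {ξ : Fin (n + 2) → ℝ} (hξ : form ξ ξ = 0) (p q : Hyp n)
    (hp : form p.1 ξ ≤ 0) :
    -form q.1 ξ ≤ exp (hdist p q) * -form p.1 ξ ∧
      exp (-hdist p q) * -form p.1 ξ ≤ -form q.1 ξ := by
  rcases eq_or_ne p q with rfl | hne
  · have : hdist p p = 0 := by rw [hdist, p.2.1, neg_neg, arcosh_zero]
    simp [this]
  obtain ⟨v, rfl, hv⟩ := exists_direction hne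
  set d := hdist (foot v) q
  have hd : 0 ≤ d := hdist_nonneg _ _
  have hq : q.1 = cosh d • v.1.1 + sinh d • v.1.2 := by rw [← hv]; rfl
  change form v.1.1 ξ ≤ 0 at hp
  change -form q.1 ξ ≤ exp d * -form v.1.1 ξ ∧ exp (-d) * -form v.1.1 ξ ≤ -form q.1 ξ
  -- Because `ξ` is null, its component tangent at `foot v` has length `-form v.1.1 ξ`; hence the
  -- direction `v.1.2` pairs with `ξ` by at most that amount.
  have h := abs_form_le (z := v.1.2) (w := ξ + form v.1.1 ξ • v.1.1)
    (a := 1) (b := -form v.1.1 ξ) v.2.1.1 v.2.2.1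
    (by rw [form_add_right, form_smul_right, v.2.1.1]; ring)
    zero_le_one (by linarith) (by rw [v.2.2.2]; ring)
    (by simp only [form_smul_right, form_add_right, form_smul_left, form_add_left,
          form_comm ξ v.1.1, v.2.1.1, hξ]
        ring)
  rw [form_add_right, form_smul_right, form_comm v.1.2 v.1.1, v.2.2.1, abs_le] at h
  have hs : 0 ≤ sinh d := sinh_nonneg_iff.2 hd
  rw [hq, form_add_left, form_smul_left, form_smul_left, ← cosh_add_sinh, ← cosh_sub_sinh]
  constructor <;> nlinarith

/-! ### Discreteness -/

/-- The point `(1, 0, …, 0)` of the hyperboloid. -/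
def origin (n : ℕ) : Hyp n := ⟨Pi.single 0 1, by simp [sheet, form]⟩

lemma form_origin (x : Fin (n + 2) → ℝ) : form x (origin n).1 = -x 0 := by
  simp [origin, form]

lemma cosh_hdist_origin (x : Hyp n) : cosh (hdist x (origin n)) = x.1 0 := by
  rw [cosh_hdist, form_origin, neg_neg]

lemma sq_le_of_mem_sheet {x : Fin (n + 2) → ℝ} (h : form x x = -1) (i : Fin (n + 2)) :
    x i ^ 2 ≤ x 0 ^ 2 := by
  refine Fin.cases le_rfl (fun j => ?_) i
  have := Finset.single_le_sum (f := fun i : Fin (n + 1) => x i.succ ^ 2)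
    (fun i _ => sq_nonneg _) (Finset.mem_univ j)
  simp only [form, ← pow_two] at h this
  linarith

lemma inv_smul_origin_val_zero (A : IsomHyp n) :
    (A⁻¹ • origin n).1 0 = (A • origin n).1 0 := by
  rw [← cosh_hdist_origin, ← cosh_hdist_origin, ← hdist_smul A, smul_inv_smul, hdist_comm]

/-- Up to sign, row `0` of `A` lists the coordinates of `A⁻¹ • origin`, whose time coordinate agrees
with that of `A • origin`. Each column has square at most `1`, so its time entry controls the other
entries. -/
lemma abs_entry_le {A : IsomHyp n} {R : ℝ} (hA : (A • origin n).1 0 ≤ R) (i j : Fin (n + 2)) :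
    |A.1.1 i j| ≤ R + 1 := by
  have hpos : 1 ≤ (A • origin n).1 0 := by rw [← cosh_hdist_origin]; exact one_le_cosh _
  refine abs_le_of_sq_le_sq ?_ (by linarith)
  have hrow : A.1.1 0 j ^ 2 ≤ R ^ 2 := by
    have h1 : form (A.1.1.mulVec (Pi.single j 1)) (origin n).1 =
        form (Pi.single j 1) (A⁻¹ • origin n).1 := by
      rw [← A.2.1 (Pi.single j 1)]
      congr 1
      change _ = (A • (A⁻¹ • origin n)).1
      rw [smul_inv_smul]
    rw [form_origin] at h1
    have h2 := sq_le_of_mem_sheet (A⁻¹ • origin n).2.1 j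
    rw [inv_smul_origin_val_zero] at h2
    have h3 : A.1.1 0 j ^ 2 = (A⁻¹ • origin n).1 j ^ 2 := by
      revert h1
      refine Fin.cases ?_ (fun k => ?_) j
      · intro h1
        simp [form] at h1
        rw [h1]
      · intro h1
        simp [form, Pi.single_apply, Fin.succ_ne_zero] at h1
        rw [← h1]
        ring
    nlinarith
  have hcol : form (A.1.1.mulVec (Pi.single j 1)) (A.1.1.mulVec (Pi.single j 1)) ≤ 1 := by
    rw [A.2.1]
    refine Fin.cases ?_ (fun k => ?_) j
    · simp [form]
    · simp [form, Pi.single_apply]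
  have hentry : A.1.1 i j ^ 2 ≤ A.1.1 0 j ^ 2 + 1 := by
    simp only [form, Matrix.mulVec_single_one, Matrix.col_apply, ← pow_two] at hcol
    refine Fin.cases (by linarith) (fun k => ?_) i
    have := Finset.single_le_sum (f := fun i : Fin (n + 1) => A.1.1 i.succ j ^ 2)
      (fun i _ => sq_nonneg _) (Finset.mem_univ k)
    beta_reduce at this
    linarith
  nlinarith

open Filter Topology in
/-- A sequence in a discrete group of isometries that moves a point a bounded amount is not
injective. -/
lemma not_injective_of_bounded {Γ : Subgroup (IsomHyp n)} [DiscreteTopology Γ] {R : ℝ}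
    (g : ℕ → Γ) (hg : ∀ k, (g k • origin n).1 0 ≤ R) : ¬ Function.Injective g := by
  intro hinj
  let E := (Fin (n + 2) → Fin (n + 2) → ℝ)
  -- The inverses are recorded too, since convergence in `GL` requires convergence of both.
  let F : ℕ → E × E := fun k => ((g k).1.1.1, (g k)⁻¹.1.1.1)
  have hR : 0 ≤ R := ((g 0 • origin n).2.2.le).trans (hg 0)
  have hF : ∀ k, F k ∈ Metric.closedBall (0 : E × E) (R + 1) := by
    intro k
    rw [mem_closedBall_zero_iff, norm_prod_le_iff]
    constructor
    · refine (pi_norm_le_iff_of_nonneg (by linarith)).2 fun i =>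
        (pi_norm_le_iff_of_nonneg (by linarith)).2 fun j => ?_
      exact abs_entry_le (A := (g k).1) (hg k) i j
    · refine (pi_norm_le_iff_of_nonneg (by linarith)).2 fun i =>
        (pi_norm_le_iff_of_nonneg (by linarith)).2 fun j => ?_
      exact abs_entry_le (A := (g k).1⁻¹) ((inv_smul_origin_val_zero _).trans_le (hg k)) i j
  obtain ⟨⟨B₀, B₀'⟩, -, σ, hσ, hlim⟩ := tendsto_subseq_of_bounded Metric.isBounded_closedBall hF
  obtain ⟨B, rfl⟩ : ∃ B : Matrix (Fin (n + 2)) (Fin (n + 2)) ℝ, B = B₀ := ⟨B₀, rfl⟩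
  obtain ⟨B', rfl⟩ : ∃ B : Matrix (Fin (n + 2)) (Fin (n + 2)) ℝ, B = B₀' := ⟨B₀', rfl⟩
  have hB : Tendsto (fun k => ((g (σ k)).1.1.1 : Matrix _ _ ℝ)) atTop (𝓝 B) :=
    (continuous_fst.tendsto _).comp hlim
  have hB' : Tendsto (fun k => ((g (σ k))⁻¹.1.1.1 : Matrix _ _ ℝ)) atTop (𝓝 B') :=
    (continuous_snd.tendsto _).comp hlim
  have hval : ∀ k, (g (σ k))⁻¹.1.1.1 * (g (σ k)).1.1.1 = 1 := fun k => by
    rw [← Units.val_mul, ← Subgroup.coe_mul, ← Subgroup.coe_mul]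
    simp
  have hBB : B' * B = 1 := by
    have := hB'.mul hB
    simp only [hval] at this
    exact (tendsto_nhds_unique this tendsto_const_nhds)
  have hs := tendsto_add_atTop_nat 1
  -- Consecutive quotients tend to `1`, so discreteness makes them eventually equal to `1`.
  have h1 : Tendsto (fun k => (g (σ k))⁻¹ * g (σ (k + 1))) atTop (𝓝 (1 : Γ)) := by
    rw [tendsto_subtype_rng, tendsto_subtype_rng,
      Units.isInducing_embedProduct.tendsto_nhds_iff]
    refine Tendsto.prodMk_nhds ?_ ?_
    · have := hB'.mul (hB.comp hs)
      rw [hBB] at this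
      simpa using this
    · refine (MulOpposite.continuous_op.tendsto _).comp ?_
      have := (hB'.comp hs).mul hB
      rw [hBB] at this
      simpa using this
  rw [nhds_discrete, tendsto_pure] at h1
  obtain ⟨k, hk⟩ := h1.exists
  have := hσ.injective (hinj (inv_mul_eq_one.1 hk))
  omega

lemma finite_of_bounded {Γ : Subgroup (IsomHyp n)} [DiscreteTopology Γ] (R : ℝ) :
    {g : Γ | (g • origin n).1 0 ≤ R}.Finite := by
  by_contra h
  have : Infinite {g : Γ | (g • origin n).1 0 ≤ R} := Set.infinite_coe_iff.2 h
  let f := Infinite.natEmbedding {g : Γ | (g • origin n).1 0 ≤ R}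
  exact not_injective_of_bounded (fun k => (f k).1) (fun k => (f k).2)
    (Subtype.val_injective.comp f.injective)

lemma hdist_smul' {Γ : Subgroup (IsomHyp n)} (g : Γ) (x y : Hyp n) :
    hdist (g • x) (g • y) = hdist x y := hdist_smul g.1 x y

lemma finite_of_hdist_le {Γ : Subgroup (IsomHyp n)} [DiscreteTopology Γ] (r D : ℝ) :
    {g : Γ | ∃ p : Hyp n, hdist p (origin n) ≤ r ∧ hdist p (g • p) ≤ D}.Finite := by
  refine (finite_of_bounded (cosh (2 * r + D))).subset ?_
  rintro g ⟨p, hp, hgp⟩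
  have h : hdist (g • origin n) (origin n) ≤ 2 * r + D := by
    have h1 := hdist_triangle (g • origin n) (g • p) (origin n)
    have h2 := hdist_triangle (g • p) p (origin n)
    rw [hdist_smul', hdist_comm (origin n)] at h1
    rw [hdist_comm (g • p) p] at h2
    linarith
  rw [hdist_le_iff ((hdist_nonneg _ _).trans h), form_origin, neg_neg] at h
  exact h

/-- A torsion-free discrete group of isometries acts freely. -/
lemma eq_one_of_smul_eq {Γ : Subgroup (IsomHyp n)} (hΓ : IsTorsionFreeCocompactLattice Γ)
    {g : Γ} {x : Hyp n} (h : g • x = x) : g = 1 := by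
  have := hΓ.discrete
  apply hΓ.torsionFree
  by_contra hfin
  have hpow : ∀ k : ℕ, g ^ k • x = x := fun k => by
    induction k with
    | zero => simp
    | succ k ih => rw [pow_succ, mul_smul, h, ih]
  refine Set.infinite_of_injective_forall_mem
    (injective_pow_iff_not_isOfFinOrder.2 hfin) (fun k => ?_)
    (finite_of_hdist_le (Γ := Γ) (hdist x (origin n)) 0)
  exact ⟨x, le_rfl, by rw [hpow, hdist, x.2.1, neg_neg, arcosh_zero]⟩

/-! ### Cocompactness -/

instance (Γ : Subgroup (IsomHyp n)) : ContinuousConstSMul Γ (Hyp n) where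
  continuous_const_smul g := by
    refine Continuous.subtype_mk ?_ _
    exact continuous_const.matrix_mulVec continuous_subtype_val

/-- The images of the balls about the origin form an increasing open cover of the compact quotient,
so a single ball meets every orbit. -/
lemma exists_bound_of_cocompact {Γ : Subgroup (IsomHyp n)}
    (hΓ : IsTorsionFreeCocompactLattice Γ) :
    ∃ R : ℝ, ∀ x : Hyp n, ∃ g : Γ, hdist (g • x) (origin n) ≤ R := by
  have := hΓ.cocompact
  let U : ℕ → Set (Mfd Γ) := fun k => Quotient.mk _ '' {x : Hyp n | hdist x (origin n) < k}
  have hU : ∀ k, IsOpen (U k) := fun k =>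
    isOpenMap_quotient_mk'_mul _
      (isOpen_lt (continuous_hdist continuous_id continuous_const) continuous_const)
  have hcover : (Set.univ : Set (Mfd Γ)) ⊆ ⋃ k, U k := by
    rintro p -
    induction p using Quotient.inductionOn with
    | h x =>
      obtain ⟨k, hk⟩ := exists_nat_gt (hdist x (origin n))
      exact Set.mem_iUnion.2 ⟨k, x, hk, rfl⟩
  have hmono : Monotone U := fun i j hij =>
    Set.image_mono fun x (hx : hdist x (origin n) < i) => hx.trans_le (Nat.cast_le.2 hij)
  obtain ⟨k, hk⟩ := isCompact_univ.elim_directed_cover U hU hcover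
    (hmono.directed_le)
  refine ⟨k, fun x => ?_⟩
  obtain ⟨y, hy, hyx⟩ := hk (Set.mem_univ (Quotient.mk _ x))
  obtain ⟨g, hg⟩ := Quotient.exact hyx
  refine ⟨g, ?_⟩
  change g • x = y at hg
  rw [hg]
  exact le_of_lt hy

lemma isCompact_hdist_le (R : ℝ) : IsCompact {x : Hyp n | hdist x (origin n) ≤ R} := by
  rcases lt_or_ge R 0 with hR | hR
  · convert isCompact_empty
    ext x
    simpa using hR.trans_le (hdist_nonneg x _)
  have hclosed : IsClosed (sheet n) := by
    have : sheet n = {x | form x x = -1 ∧ 0 ≤ x 0} := by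
      ext x
      refine ⟨fun h => ⟨h.1, h.2.le⟩, fun h => ⟨h.1, lt_of_le_of_ne h.2 fun h0 => ?_⟩⟩
      have := sq_zero_of_form h.1
      rw [← h0] at this
      norm_num at this
    rw [this]
    exact (isClosed_eq (continuous_form continuous_id continuous_id) continuous_const).inter
      (isClosed_le continuous_const (continuous_apply 0))
  refine (hclosed.isClosedEmbedding_subtypeVal.isCompact_preimage
    (isCompact_closedBall (0 : Fin (n + 2) → ℝ) (cosh R))).of_isClosed_subset
    (isClosed_le (continuous_hdist continuous_id continuous_const) continuous_const) ?_
  intro x hx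
  have hx : hdist x (origin n) ≤ R := hx
  rw [hdist_le_iff hR, form_origin, neg_neg] at hx
  simp only [Set.mem_preimage, mem_closedBall_zero_iff]
  refine (pi_norm_le_iff_of_nonneg (cosh_pos R).le).2 fun i => ?_
  exact abs_le_of_sq_le_sq ((sq_le_of_mem_sheet x.2.1 i).trans
    (pow_le_pow_left₀ x.2.2.le hx 2)) (cosh_pos R).le

/-- The displacement function of an element of a cocompact lattice attains its minimum. -/
lemma exists_min_displacement {Γ : Subgroup (IsomHyp n)}
    (hΓ : IsTorsionFreeCocompactLattice Γ) (η : Γ) :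
    ∃ p : Hyp n, ∀ q : Hyp n, hdist p (η • p) ≤ hdist q (η • q) := by
  have := hΓ.discrete
  obtain ⟨R, hR⟩ := exists_bound_of_cocompact hΓ
  set K := {x : Hyp n | hdist x (origin n) ≤ R} with hK
  have hconj : ∀ (h : Γ) (q : Hyp n), hdist (h • q) ((h * η * h⁻¹) • h • q) = hdist q (η • q) :=
    fun h q => by rw [mul_smul, mul_smul, inv_smul_smul, hdist_smul']
  let D := hdist (origin n) (η • origin n)
  -- Moving a point into the compact ball `K` conjugates `η`. Only finitely many conjugates displace
  -- some point of `K` by at most `D`; the displacement is minimized on `K` for each, then over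
  -- these conjugates.
  let F : Set Γ := {g | ∃ p : Hyp n, hdist p (origin n) ≤ R ∧ hdist p (g • p) ≤ D} ∩
    {g | ∃ h : Γ, g = h * η * h⁻¹}
  have hF : F.Finite := (finite_of_hdist_le R D).subset Set.inter_subset_left
  have hmem : ∀ (h : Γ) (q : Hyp n), h • q ∈ K → hdist q (η • q) ≤ D → h * η * h⁻¹ ∈ F :=
    fun h q hq hD => ⟨⟨h • q, hq, (hconj h q).trans_le hD⟩, h, rfl⟩
  obtain ⟨h₀, hh₀⟩ := hR (origin n)
  have hmin : ∀ g : Γ, ∃ p ∈ K, ∀ q ∈ K, hdist p (g • p) ≤ hdist q (g • q) := fun g => by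
    obtain ⟨p, hp, hmin⟩ := (isCompact_hdist_le (n := n) R).exists_isMinOn ⟨h₀ • origin n, hh₀⟩
      (continuous_hdist continuous_id (continuous_const_smul g)).continuousOn
    exact ⟨p, hp, fun q hq => hmin hq⟩
  choose m hm hmle using hmin
  obtain ⟨g, ⟨-, h, rfl⟩, hgmin⟩ := Set.exists_min_image F (fun g => hdist (m g) (g • m g)) hF
    ⟨_, hmem h₀ (origin n) hh₀ le_rfl⟩
  refine ⟨h⁻¹ • m (h * η * h⁻¹), fun q => ?_⟩
  rw [← hconj h (h⁻¹ • _), smul_inv_smul]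
  have key : ∀ q : Hyp n, hdist q (η • q) ≤ D →
      hdist (m (h * η * h⁻¹)) ((h * η * h⁻¹) • m (h * η * h⁻¹)) ≤ hdist q (η • q) := by
    intro q hq
    obtain ⟨k, hk⟩ := hR q
    refine (hgmin _ (hmem k q hk hq)).trans ?_
    rw [← hconj k q]
    exact hmle _ _ hk
  rcases le_total (hdist q (η • q)) D with hq | hq
  · exact key q hq
  · exact (key (origin n) le_rfl).trans hq

/-- A nontrivial element of a torsion-free cocompact lattice translates a geodesic by its minimal
displacement. -/
lemma exists_axis {Γ : Subgroup (IsomHyp n)} (hΓ : IsTorsionFreeCocompactLattice Γ) {η : Γ}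
    (hη : η ≠ 1) : ∃ (w : UnitTangent n) (ℓ : ℝ), 0 < ℓ ∧ η • w = flow ℓ w ∧
      ∀ q : Hyp n, ℓ ≤ hdist q (η • q) := by
  obtain ⟨p, hp⟩ := exists_min_displacement hΓ η
  have hne : p ≠ η • p := fun h => hη (eq_one_of_smul_eq hΓ h.symm)
  obtain ⟨w, rfl, hw⟩ := exists_direction hne
  have hpos : 0 < hdist (foot w) (η • foot w) :=
    lt_of_le_of_ne (hdist_nonneg _ _) fun h0 => hne (eq_of_hdist_eq_zero h0.symm)
  generalize hℓ : hdist (foot w) (η • foot w) = ℓ at *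
  refine ⟨w, ℓ, hpos, ?_, hp⟩
  have h1 : (η • w).1.1 = (flow ℓ w).1.1 := (congrArg Subtype.val hw).symm
  obtain ⟨z, hz⟩ : ∃ z, z = flow ℓ w := ⟨_, rfl⟩
  rw [← hz] at h1 ⊢
  -- The midpoint of the segment from `foot w` to `η • foot w` goes to the midpoint of the next
  -- segment. A corner at `η • foot w` would make these midpoints closer than `ℓ`, against
  -- minimality.
  have hmid : foot (flow (ℓ / 2) w) = foot (flow (-(ℓ / 2)) z) := by
    rw [hz, flow_flow]
    congr 2
    ring
  have hdisp := hp (foot (flow (ℓ / 2) w))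
  have hη' : η • foot (flow (ℓ / 2) w) = foot (flow (ℓ / 2) (η • w)) :=
    congrArg foot (flow_smul (ℓ / 2) η.1 w).symm
  rw [hη', hmid] at hdisp
  have hcosh : cosh ℓ ≤ -form (foot (flow (-(ℓ / 2)) z)).1 (foot (flow (ℓ / 2) (η • w))).1 := by
    rw [← cosh_hdist, cosh_le_cosh, abs_of_pos hpos, abs_of_nonneg (hdist_nonneg _ _)]
    exact hdisp
  change cosh ℓ ≤ -form (flow (-(ℓ / 2)) z).1.1 (flow (ℓ / 2) (η • w)).1.1 at hcosh
  have hzη : form z.1.1 (η • w).1.2 = 0 := by rw [← h1]; exact (η • w).2.2.1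
  have hηη : form (η • w).1.2 (η • w).1.2 = 1 := (η • w).2.2.2
  rw [flow_val_fst (-(ℓ / 2)), flow_val_fst (ℓ / 2), h1, form_comb, z.2.1.1, hzη,
    form_comm z.1.2 z.1.1, z.2.2.1, cosh_neg, sinh_neg] at hcosh
  have h2 : cosh ℓ = cosh (ℓ / 2) ^ 2 + sinh (ℓ / 2) ^ 2 := by
    rw [← cosh_two_mul]; congr 1; ring
  have hs : 0 < sinh (ℓ / 2) ^ 2 := pow_pos (sinh_pos_iff.2 (by linarith)) 2
  -- The unit vectors arriving at and leaving `η • foot w` have inner product at least `1`, so they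
  -- coincide.
  have h3 : 1 ≤ form z.1.2 (η • w).1.2 := by
    by_contra hlt
    nlinarith
  have h4 : (η • w).1.2 - z.1.2 = 0 := by
    apply eq_zero_of_form_self z.2.1.1
    · rw [form_sub_right, hzη, z.2.2.1, sub_zero]
    · rw [form_sub_left, form_sub_right, form_sub_right, hηη, z.2.2.2, form_comm _ z.1.2]
      linarith
  exact Subtype.ext (Prod.ext h1 (sub_eq_zero.1 h4))

/-! ### Geodesics that are nearly translated along an axis -/

/-- If `p(t) = a e ^ t + b e ^ (-t)` and `q(t) = c e ^ t + d e ^ (-t)` change by the factors `Λ`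
and `Λ⁻¹`, up to the factor `E`, under a time shift, then `a` and `d` dominate. Here `S`, `L`, `Λ`,
`E` are the exponentials of the time shift, the time interval, the translation length and the
error. -/
lemma dominant_coefficients {a b c d S L Λ E : ℝ} (ha : 0 ≤ a) (hb : 0 ≤ b) (hc : 0 ≤ c)
    (hd : 0 ≤ d) (hab : 0 < a + b) (hE : 1 ≤ E) (hΛ : 1 ≤ Λ) (hS : 2 * E ≤ S) (hL : 2 * E ≤ L)
    (h1 : Λ * (a + b) ≤ E * (a * S + b * S⁻¹))
    (h2 : a * (S * L) + b * (S * L)⁻¹ ≤ E * Λ * (a * L + b * L⁻¹))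
    (h3 : Λ * (c * (S * L) + d * (S * L)⁻¹) ≤ E * (c * L + d * L⁻¹)) :
    0 < a ∧ b ≤ 4 * E ^ 2 * a ∧ c * (S * L) ^ 2 ≤ 4 * E ^ 2 * d := by
  have hS0 : 0 < S := by linarith
  have hL0 : 0 < L := by linarith
  have hE0 : 0 < E := by linarith
  have hΛ0 : 0 < Λ := by linarith
  have hES : E * S⁻¹ ≤ 1 / 2 := by
    rw [← div_eq_mul_inv, div_le_iff₀ hS0]
    linarith
  have k1 : b * Λ ≤ 2 * a * E * S := by
    have e1 : b * (E * S⁻¹) ≤ b * (Λ / 2) := mul_le_mul_of_nonneg_left (by linarith) hb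
    have e2 : 0 ≤ Λ * a := by positivity
    linarith
  have k2 : a * S ≤ 2 * E * Λ * a := by
    have e1 : 0 ≤ b * (S * L)⁻¹ := by positivity
    have e2 : a * (S * L) ≤ E * Λ * (a * L + b * L⁻¹) := by linarith
    have e3 : a * S * L ^ 2 ≤ E * Λ * a * L ^ 2 + E * (b * Λ) := by
      have := mul_le_mul_of_nonneg_right e2 hL0.le
      calc a * S * L ^ 2 = a * (S * L) * L := by ring
        _ ≤ E * Λ * (a * L + b * L⁻¹) * L := this
        _ = _ := by field_simp
    have e4 : E * (b * Λ) ≤ E * (2 * a * E * S) := mul_le_mul_of_nonneg_left k1 hE0.le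
    have e5 : a * S * (4 * E ^ 2) ≤ a * S * L ^ 2 :=
      mul_le_mul_of_nonneg_left (by nlinarith) (by positivity)
    have e6 : a * S * L ^ 2 ≤ 2 * E * Λ * a * L ^ 2 := by linarith
    exact le_of_mul_le_mul_right e6 (by positivity)
  have k3 : b ≤ 4 * E ^ 2 * a := by
    have : b * Λ ≤ 4 * E ^ 2 * a * Λ := by
      calc b * Λ ≤ 2 * E * (a * S) := by linarith
        _ ≤ 2 * E * (2 * E * Λ * a) := mul_le_mul_of_nonneg_left k2 (by positivity)
        _ = _ := by ring
    exact le_of_mul_le_mul_right this hΛ0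
  have ha' : 0 < a := by
    rcases ha.eq_or_lt with rfl | h
    · simp only [mul_zero] at k3
      linarith
    · exact h
  refine ⟨ha', k3, ?_⟩
  have k4 : S ≤ 2 * E * Λ := le_of_mul_le_mul_left (by linarith) ha'
  have k5 : c * L ^ 2 * Λ * S ≤ 2 * E * d := by
    have e1 : 0 ≤ Λ * (d * (S * L)⁻¹) := by positivity
    have e2 : Λ * (c * (S * L)) ≤ E * (c * L + d * L⁻¹) := by linarith
    have e3 : c * L ^ 2 * Λ * S ≤ E * (c * L ^ 2) + E * d := by
      have := mul_le_mul_of_nonneg_right e2 hL0.le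
      calc c * L ^ 2 * Λ * S = Λ * (c * (S * L)) * L := by ring
        _ ≤ E * (c * L + d * L⁻¹) * L := this
        _ = _ := by field_simp
    have e4 : c * L ^ 2 * (2 * E) ≤ c * L ^ 2 * (Λ * S) :=
      mul_le_mul_of_nonneg_left (by nlinarith) (by positivity)
    linarith
  have k6 : c * (S * L) ^ 2 * Λ ≤ 4 * E ^ 2 * d * Λ := by
    calc c * (S * L) ^ 2 * Λ = c * L ^ 2 * Λ * S * S := by ring
      _ ≤ 2 * E * d * S := mul_le_mul_of_nonneg_right k5 hS0.le
      _ ≤ 2 * E * d * (2 * E * Λ) := mul_le_mul_of_nonneg_left k4 (by positivity)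
      _ = _ := by ring
  exact le_of_mul_le_mul_right k6 hΛ0

/-- The Gram inequality says `(√(ad) - √(bc))² ≤ 1`, while `hbc` says `√(bc) ≤ δ √(ad)`. -/
lemma sqrt_mul_le_of_gram {a b c d δ : ℝ} (ha : 0 < a) (hb : 0 ≤ b) (hc : 0 ≤ c) (hd : 0 < d)
    (hδ0 : 0 ≤ δ) (hbc : b * c ≤ δ ^ 2 * (a * d))
    (hgram : (a * d + b * c - 1) ^ 2 ≤ 4 * (a * b * c * d)) :
    √(a * d) * (1 - δ) ≤ 1 := by
  set r := √(a * d)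
  set q := √(b * c)
  have hr : r ^ 2 = a * d := sq_sqrt (by positivity)
  have hq : q ^ 2 = b * c := sq_sqrt (by positivity)
  have hr0 : 0 ≤ r := sqrt_nonneg _
  have hq0 : 0 ≤ q := sqrt_nonneg _
  have h1 : q ≤ δ * r := by
    apply le_of_sq_le_sq _ (by positivity)
    rw [mul_pow, hr, hq]
    exact hbc
  have h2 : r ^ 2 + q ^ 2 - 1 ≤ 2 * r * q := by
    apply le_of_sq_le_sq _ (by positivity)
    rw [mul_pow, mul_pow, hr, hq]
    linarith
  have h3 : r - q ≤ 1 := by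
    apply le_of_sq_le_sq _ zero_le_one
    linarith
  linarith

lemma null_add (v : UnitTangent n) : form (v.1.1 + v.1.2) (v.1.1 + v.1.2) = 0 := by
  simp only [form_add_left, form_add_right, form_comm v.1.2 v.1.1, v.2.1.1, v.2.2.1, v.2.2.2]
  ring

lemma null_sub (v : UnitTangent n) : form (v.1.1 - v.1.2) (v.1.1 - v.1.2) = 0 := by
  simp only [form_sub_left, form_sub_right, form_comm v.1.2 v.1.1, v.2.1.1, v.2.2.1, v.2.2.2]
  ring

lemma form_base_add (v : UnitTangent n) : form (foot v).1 (v.1.1 + v.1.2) = -1 := by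
  change form v.1.1 _ = _
  rw [form_add_right, v.2.1.1, v.2.2.1, add_zero]

lemma form_base_sub (v : UnitTangent n) : form (foot v).1 (v.1.1 - v.1.2) = -1 := by
  change form v.1.1 _ = _
  rw [form_sub_right, v.2.1.1, v.2.2.1, sub_zero]

lemma form_null_neg {ξ : Fin (n + 2) → ℝ} (hξ : form ξ ξ = 0) {p : Hyp n} (hp : form p.1 ξ = -1)
    (q : Hyp n) : form q.1 ξ < 0 := by
  have := (neg_form_null_bounds hξ p q (by linarith)).2
  rw [hp] at this
  linarith [exp_pos (-hdist p q)]

lemma neg_form_flow (v : UnitTangent n) (ξ : Fin (n + 2) → ℝ) (t : ℝ) :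
    -form (foot (flow t v)).1 ξ = -form (v.1.1 + v.1.2) ξ / 2 * exp t +
      -form (v.1.1 - v.1.2) ξ / 2 * exp (-t) := by
  change -form (cosh t • v.1.1 + sinh t • v.1.2) ξ = _
  rw [← cosh_add_sinh, ← cosh_sub_sinh]
  simp only [form_add_left, form_sub_left, form_smul_left]
  ring

/-- If an isometry translating the geodesic of `w` by `ℓ` nearly shifts the geodesic of `v` by time
`s` on the time interval `[0, l]`, then away from the ends of `[0, s + l]` the geodesic of `v` is
close to that of `w`. -/
lemma exists_shift_close {ε s l ℓ c₀ δ : ℝ} (hε : 0 < ε) (hs : ε + 1 ≤ s) (hl : ε + 1 ≤ l)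
    (hℓ : 0 ≤ ℓ) (hc₀ : 2 * c₀ ≤ s + l) (hδ : δ = 4 * exp (2 * ε - 2 * c₀)) (hδ1 : δ < 1)
    (hδε : (1 + δ) / (1 - δ) ≤ cosh (ε / 2)) {η : IsomHyp n} {w v : UnitTangent n}
    (hw : η • w = flow ℓ w)
    (hclose : ∀ τ ∈ Set.Icc 0 l, hdist (η • foot (flow τ v)) (foot (flow (s + τ) v)) ≤ ε) :
    ∃ κ : ℝ, ∀ t ∈ Set.Icc c₀ (s + l - c₀),
      hdist (foot (flow t v)) (foot (flow (t + κ) w)) ≤ ε / 2 := by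
  have hδ0 : 0 < δ := by rw [hδ]; positivity
  -- The null vectors `e` and `f` represent the forward and backward endpoints of the axis.
  set e := w.1.1 + w.1.2 with he
  set f := w.1.1 - w.1.2 with hf
  have hee : form e e = 0 := null_add w
  have hff : form f f = 0 := null_sub w
  have hew : form (foot w).1 e = -1 := form_base_add w
  have hfw : form (foot w).1 f = -1 := form_base_sub w
  have hη1 : η.1.1.mulVec w.1.1 = cosh ℓ • w.1.1 + sinh ℓ • w.1.2 :=
    congrArg (fun u : UnitTangent n => u.1.1) hw
  have hη2 : η.1.1.mulVec w.1.2 = sinh ℓ • w.1.1 + cosh ℓ • w.1.2 :=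
    congrArg (fun u : UnitTangent n => u.1.2) hw
  have hηe (p : Hyp n) : form (η • p).1 e = exp (-ℓ) * form p.1 e := by
    rw [← η.2.1 p.1 e, he, Matrix.mulVec_add, hη1, hη2]
    have : cosh ℓ • w.1.1 + sinh ℓ • w.1.2 + (sinh ℓ • w.1.1 + cosh ℓ • w.1.2) =
        exp ℓ • (w.1.1 + w.1.2) := by
      rw [← cosh_add_sinh]
      module
    rw [this, form_smul_right, ← mul_assoc, ← exp_add, neg_add_cancel, exp_zero, one_mul]
    rfl
  have hηf (p : Hyp n) : form (η • p).1 f = exp ℓ * form p.1 f := by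
    rw [← η.2.1 p.1 f, hf, Matrix.mulVec_sub, hη1, hη2]
    have : cosh ℓ • w.1.1 + sinh ℓ • w.1.2 - (sinh ℓ • w.1.1 + cosh ℓ • w.1.2) =
        exp (-ℓ) • (w.1.1 - w.1.2) := by
      rw [← cosh_sub_sinh]
      module
    rw [this, form_smul_right, ← mul_assoc, ← exp_add, add_neg_cancel, exp_zero, one_mul]
    rfl
  obtain ⟨a, ha⟩ : ∃ a, a = -form (v.1.1 + v.1.2) f / 2 := ⟨_, rfl⟩
  obtain ⟨b, hb⟩ : ∃ b, b = -form (v.1.1 - v.1.2) f / 2 := ⟨_, rfl⟩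
  obtain ⟨c, hc⟩ : ∃ c, c = -form (v.1.1 + v.1.2) e / 2 := ⟨_, rfl⟩
  obtain ⟨d, hd⟩ : ∃ d, d = -form (v.1.1 - v.1.2) e / 2 := ⟨_, rfl⟩
  have hP (t : ℝ) : -form (foot (flow t v)).1 f = a * exp t + b * exp (-t) := by
    rw [neg_form_flow, ha, hb]
  have hQ (t : ℝ) : -form (foot (flow t v)).1 e = c * exp t + d * exp (-t) := by
    rw [neg_form_flow, hc, hd]
  have hneg (t : ℝ) : form (foot (flow t v)).1 f < 0 := form_null_neg hff hfw _
  have hneg' (t : ℝ) : form (foot (flow t v)).1 e < 0 := form_null_neg hee hew _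
  have ha0 : 0 ≤ a := by
    have := form_null_null_nonpos (null_add v) hff (foot v) (by rw [form_base_add]; norm_num)
      (form_null_neg hff hfw _).le
    linarith
  have hb0 : 0 ≤ b := by
    have := form_null_null_nonpos (null_sub v) hff (foot v) (by rw [form_base_sub]; norm_num)
      (form_null_neg hff hfw _).le
    linarith
  have hc0 : 0 ≤ c := by
    have := form_null_null_nonpos (null_add v) hee (foot v) (by rw [form_base_add]; norm_num)
      (form_null_neg hee hew _).le
    linarith
  have hd0 : 0 ≤ d := by
    have := form_null_null_nonpos (null_sub v) hee (foot v) (by rw [form_base_sub]; norm_num)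
      (form_null_neg hee hew _).le
    linarith
  have hab : 0 < a + b := by
    have h1 := hP 0
    have h2 := hneg 0
    simp only [exp_zero, neg_zero, mul_one] at h1
    linarith
  have hcd : 0 < c + d := by
    have h1 := hQ 0
    have h2 := hneg' 0
    simp only [exp_zero, neg_zero, mul_one] at h1
    linarith
  have hηneg (t : ℝ) : form (η • foot (flow t v)).1 f ≤ 0 := (form_null_neg hff hfw _).le
  have hηneg' (t : ℝ) : form (η • foot (flow t v)).1 e ≤ 0 := (form_null_neg hee hew _).le
  -- Applying `η` multiplies the pairing with `f` by `exp ℓ` exactly, and moving a distance at most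
  -- `ε` changes it by a factor at most `exp ε`.
  have key1 (τ : ℝ) (hτ : τ ∈ Set.Icc 0 l) :
      exp ℓ * (a * exp τ + b * exp (-τ)) ≤
        exp ε * (a * exp (s + τ) + b * exp (-(s + τ))) := by
    have h := (neg_form_null_bounds hff (foot (flow (s + τ) v)) (η • foot (flow τ v))
      (hneg _).le).1
    rw [hηf, ← mul_neg, hP, hP, hdist_comm] at h
    refine h.trans (mul_le_mul_of_nonneg_right (exp_le_exp.2 (hclose τ hτ)) (by positivity))
  have key2 (τ : ℝ) (hτ : τ ∈ Set.Icc 0 l) :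
      a * exp (s + τ) + b * exp (-(s + τ)) ≤
        exp ε * exp ℓ * (a * exp τ + b * exp (-τ)) := by
    have h := (neg_form_null_bounds hff (η • foot (flow τ v)) (foot (flow (s + τ) v))
      (hηneg _)).1
    rw [hηf, ← mul_neg, hP, hP] at h
    rw [mul_assoc]
    refine h.trans (mul_le_mul_of_nonneg_right (exp_le_exp.2 (hclose τ hτ)) (by positivity))
  have key3 (τ : ℝ) (hτ : τ ∈ Set.Icc 0 l) :
      exp ℓ * (c * exp (s + τ) + d * exp (-(s + τ))) ≤
        exp ε * (c * exp τ + d * exp (-τ)) := by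
    have h := (neg_form_null_bounds hee (η • foot (flow τ v)) (foot (flow (s + τ) v))
      (hηneg' _)).1
    rw [hηe, ← mul_neg, hQ, hQ] at h
    have h' := h.trans
      (mul_le_mul_of_nonneg_right (exp_le_exp.2 (hclose τ hτ)) (by positivity))
    calc _ ≤ exp ℓ * (exp ε * (exp (-ℓ) * (c * exp τ + d * exp (-τ)))) :=
          mul_le_mul_of_nonneg_left h' (exp_pos ℓ).le
      _ = (exp ℓ * exp (-ℓ)) * (exp ε * (c * exp τ + d * exp (-τ))) := by ring
      _ = _ := by rw [← exp_add, add_neg_cancel, exp_zero, one_mul]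
  have hexp (x : ℝ) (hx : ε + 1 ≤ x) : 2 * exp ε ≤ exp x := by
    refine le_trans ?_ (exp_le_exp.2 hx)
    rw [exp_add, mul_comm]
    exact mul_le_mul_of_nonneg_left (by linarith [add_one_le_exp 1]) (exp_pos ε).le
  have hl0 : 0 ≤ l := by linarith
  have k1 := key1 0 ⟨le_rfl, hl0⟩
  have k2 := key2 l ⟨hl0, le_rfl⟩
  have k3 := key3 l ⟨hl0, le_rfl⟩
  simp only [exp_neg, exp_add, exp_zero, inv_one, mul_one] at k1 k2 k3
  obtain ⟨ha', hba, hcd'⟩ := dominant_coefficients ha0 hb0 hc0 hd0 hab (one_le_exp hε.le)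
    (one_le_exp hℓ) (hexp s hs) (hexp l hl) k1 k2 k3
  -- This is where `c₀` enters: past time `c₀` the subordinate term `b e^{-t}` is at most `δ` times
  -- `a e^t`, and symmetrically for `c`, `d` before time `s + l - c₀`.
  have hE2 : 4 * exp ε ^ 2 = δ * exp c₀ ^ 2 := by
    rw [hδ, exp_sub, mul_comm 2 ε, mul_comm 2 c₀, exp_mul, exp_mul]
    norm_num
    field_simp
  have hd' : 0 < d := by
    rcases hd0.eq_or_lt with h | h
    · rw [← h, mul_zero] at hcd'
      have : c ≤ 0 := by
        by_contra hcpos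
        have : 0 < c * (exp s * exp l) ^ 2 := mul_pos (not_le.1 hcpos) (by positivity)
        linarith
      linarith
    · exact h
  have hbt (t : ℝ) (ht : c₀ ≤ t) : b * exp (-t) ^ 2 ≤ δ * a := by
    calc b * exp (-t) ^ 2 ≤ 4 * exp ε ^ 2 * a * exp (-t) ^ 2 :=
          mul_le_mul_of_nonneg_right hba (by positivity)
      _ = δ * a * (exp c₀ * exp (-t)) ^ 2 := by rw [hE2]; ring
      _ ≤ δ * a * 1 := by
          refine mul_le_mul_of_nonneg_left (pow_le_one₀ (by positivity) ?_) (by positivity)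
          rw [← exp_add]
          exact exp_le_one_iff.2 (by linarith)
      _ = δ * a := mul_one _
  have hct (t : ℝ) (ht : t ≤ s + l - c₀) : c * exp t ^ 2 ≤ δ * d := by
    calc c * exp t ^ 2 = c * (exp s * exp l) ^ 2 * exp (t - (s + l)) ^ 2 := by
          rw [← exp_add, mul_assoc, ← mul_pow, ← exp_add]
          congr 3
          ring
      _ ≤ 4 * exp ε ^ 2 * d * exp (t - (s + l)) ^ 2 :=
          mul_le_mul_of_nonneg_right hcd' (by positivity)
      _ = δ * d * (exp c₀ * exp (t - (s + l))) ^ 2 := by rw [hE2]; ring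
      _ ≤ δ * d * 1 := by
          refine mul_le_mul_of_nonneg_left (pow_le_one₀ (by positivity) ?_) (by positivity)
          rw [← exp_add]
          exact exp_le_one_iff.2 (by linarith)
      _ = δ * d := mul_one _
  have hbc : b * c ≤ δ ^ 2 * (a * d) := by
    have h1 := hbt c₀ le_rfl
    have h2 := hct c₀ (by linarith)
    calc b * c = (b * exp (-c₀) ^ 2) * (c * exp c₀ ^ 2) := by
          have : exp (-c₀) * exp c₀ = 1 := by rw [← exp_add, neg_add_cancel, exp_zero]
          calc b * c = b * c * (exp (-c₀) * exp c₀) ^ 2 := by rw [this]; ring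
            _ = _ := by ring
      _ ≤ (δ * a) * (δ * d) := mul_le_mul h1 h2 (by positivity) (by positivity)
      _ = _ := by ring
  have hgram : (a * d + b * c - 1) ^ 2 ≤ 4 * (a * b * c * d) := by
    -- Subtracting the projections onto the span of `e` and `f` leaves two vectors orthogonal to the
    -- axis plane, where Cauchy–Schwarz applies.
    have h := form_sq_le (y := w.1.1) (z := v.1.1 + v.1.2 - (a • e + c • f))
      (w := v.1.1 - v.1.2 - (b • e + d • f)) w.2.1.1
      (by
        simp only [ha, hc, he, hf, form_sub_right, form_add_left, form_add_right, form_smul_right,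
          w.2.1.1, w.2.2.1, form_comm w.1.1 v.1.1, form_comm w.1.1 v.1.2]
        ring)
      (by
        simp only [hb, hd, he, hf, form_sub_left, form_sub_right, form_add_right, form_smul_right,
          w.2.1.1, w.2.2.1, form_comm w.1.1 v.1.1, form_comm w.1.1 v.1.2]
        ring)
    have e1 : form (v.1.1 + v.1.2 - (a • e + c • f)) (v.1.1 - v.1.2 - (b • e + d • f)) =
        2 * (a * d + b * c - 1) := by
      simp only [ha, hb, hc, hd, he, hf, form_sub_left, form_sub_right, form_add_left,
        form_add_right, form_smul_right, form_smul_left, w.2.1.1, w.2.2.1, w.2.2.2, v.2.1.1,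
        v.2.2.1, v.2.2.2, form_comm w.1.1 v.1.1, form_comm w.1.1 v.1.2, form_comm w.1.2 v.1.1,
        form_comm w.1.2 v.1.2, form_comm w.1.2 w.1.1, form_comm v.1.2 v.1.1]
      ring
    have e2 : form (v.1.1 + v.1.2 - (a • e + c • f)) (v.1.1 + v.1.2 - (a • e + c • f)) =
        4 * (a * c) := by
      simp only [ha, hc, he, hf, form_sub_left, form_sub_right, form_add_left,
        form_add_right, form_smul_right, form_smul_left, w.2.1.1, w.2.2.1, w.2.2.2, v.2.1.1,
        v.2.2.1, v.2.2.2, form_comm w.1.1 v.1.1, form_comm w.1.1 v.1.2, form_comm w.1.2 v.1.1,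
        form_comm w.1.2 v.1.2, form_comm w.1.2 w.1.1, form_comm v.1.2 v.1.1]
      ring
    have e3 : form (v.1.1 - v.1.2 - (b • e + d • f)) (v.1.1 - v.1.2 - (b • e + d • f)) =
        4 * (b * d) := by
      simp only [hb, hd, he, hf, form_sub_left, form_sub_right, form_add_left,
        form_add_right, form_smul_right, form_smul_left, w.2.1.1, w.2.2.1, w.2.2.2, v.2.1.1,
        v.2.2.1, v.2.2.2, form_comm w.1.1 v.1.1, form_comm w.1.1 v.1.2, form_comm w.1.2 v.1.1,
        form_comm w.1.2 v.1.2, form_comm w.1.2 w.1.1, form_comm v.1.2 v.1.1]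
      ring
    rw [e1, e2, e3] at h
    linarith
  have hroot := sqrt_mul_le_of_gram ha' hb0 hc0 hd' hδ0.le hbc hgram
  -- The shift `log k` balances the two dominant terms `e^{κ} d` and `e^{-κ} a` of the cosh of the
  -- distance; both become `√(ad)`.
  set k := √(a / d) with hk
  have hk0 : 0 < k := sqrt_pos.2 (div_pos ha' hd')
  have hk2 : k ^ 2 * d = a := by
    rw [hk, sq_sqrt (div_pos ha' hd').le]
    field_simp
  have hr : √(a * d) = k * d := by
    rw [← hk2, show k ^ 2 * d * d = (k * d) ^ 2 by ring, sqrt_sq (by positivity)]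
  rw [hr] at hroot
  refine ⟨log k, fun t ht => ?_⟩
  rw [hdist_le_iff (by linarith)]
  refine le_trans ?_ hδε
  have hval : -form (foot (flow t v)).1 (foot (flow (t + log k) w)).1 =
      (exp (t + log k) * (c * exp t + d * exp (-t)) +
        exp (-(t + log k)) * (a * exp t + b * exp (-t))) / 2 := by
    rw [← hP, ← hQ, form_comm, neg_eq_iff_eq_neg.1 (neg_form_flow w _ (t + log k)), ← he, ← hf,
      form_comm e, form_comm f]
    ring
  have hexpr : (exp (t + log k) * (c * exp t + d * exp (-t)) +
        exp (-(t + log k)) * (a * exp t + b * exp (-t))) / 2 =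
      (k * (c * exp t ^ 2) + k * d + (a + b * exp (-t) ^ 2) / k) / 2 := by
    rw [neg_add, exp_add, exp_add, exp_neg (log k), exp_log hk0, exp_neg t]
    field_simp
  rw [hval, hexpr, le_div_iff₀ (by linarith)]
  have h1 : k * (c * exp t ^ 2) ≤ k * (δ * d) := mul_le_mul_of_nonneg_left (hct t ht.2) hk0.le
  have h2 : (a + b * exp (-t) ^ 2) / k ≤ (1 + δ) * (k * d) := by
    rw [div_le_iff₀ hk0]
    have := hbt t ht.1
    calc a + b * exp (-t) ^ 2 ≤ (1 + δ) * a := by linarith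
      _ = (1 + δ) * (k * d) * k := by rw [← hk2]; ring
  have h3 : (k * (c * exp t ^ 2) + k * d + (a + b * exp (-t) ^ 2) / k) / 2 ≤
      (1 + δ) * (k * d) := by linarith
  calc _ ≤ (1 + δ) * (k * d) * (1 - δ) := mul_le_mul_of_nonneg_right h3 (by linarith)
    _ = (1 + δ) * (k * d * (1 - δ)) := by ring
    _ ≤ (1 + δ) * 1 := mul_le_mul_of_nonneg_left hroot (by linarith)
    _ = 1 + δ := mul_one _

/-! ### The quotient manifold -/

variable {Γ : Subgroup (IsomHyp n)}

lemma mdist_bddBelow (p q : Mfd Γ) :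
    BddBelow {r | ∃ x y : Hyp n, Quotient.mk _ x = p ∧ Quotient.mk _ y = q ∧ hdist x y = r} :=
  ⟨0, by rintro _ ⟨x, y, -, -, rfl⟩; exact hdist_nonneg x y⟩

lemma mdist_mk_le (x y : Hyp n) :
    mdist (Quotient.mk _ x : Mfd Γ) (Quotient.mk _ y) ≤ hdist x y :=
  csInf_le (mdist_bddBelow _ _) ⟨x, y, rfl, rfl, rfl⟩

lemma mdist_nonneg (p q : Mfd Γ) : 0 ≤ mdist p q :=
  Real.sInf_nonneg (by rintro _ ⟨x, y, -, -, rfl⟩; exact hdist_nonneg x y)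

lemma mdist_comm (p q : Mfd Γ) : mdist p q = mdist q p := by
  unfold mdist
  congr 1
  ext r
  constructor <;> rintro ⟨x, y, hx, hy, h⟩ <;> exact ⟨y, x, hy, hx, by rw [hdist_comm, h]⟩

/-- The group acts by isometries, so one of the two lifts may be held fixed. -/
lemma exists_smul_of_mdist_lt {x y : Hyp n} {r : ℝ}
    (h : mdist (Quotient.mk _ x : Mfd Γ) (Quotient.mk _ y) < r) :
    ∃ g : Γ, hdist (g • x) y < r := by
  obtain ⟨_, ⟨x', y', hx, hy, rfl⟩, hr⟩ := exists_lt_of_csInf_lt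
    (Set.nonempty_of_mem (x := hdist x y) (by exact ⟨x, y, rfl, rfl, rfl⟩)) h
  obtain ⟨g, hg⟩ := Quotient.exact hx
  obtain ⟨k, hk⟩ := Quotient.exact hy
  change g • x = x' at hg
  change k • y = y' at hk
  refine ⟨k⁻¹ * g, ?_⟩
  rwa [mul_smul, hg, ← hdist_smul' k, smul_inv_smul, hk]

lemma mdist_triangle (p q r : Mfd Γ) : mdist p r ≤ mdist p q + mdist q r := by
  induction p using Quotient.inductionOn with | h x =>
  induction q using Quotient.inductionOn with | h y =>
  induction r using Quotient.inductionOn with | h z =>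
  refine le_of_forall_pos_le_add fun δ hδ => ?_
  obtain ⟨g, hg⟩ := exists_smul_of_mdist_lt (Γ := Γ) (x := x) (y := y)
    (lt_add_of_pos_right _ (half_pos hδ))
  obtain ⟨k, hk⟩ := exists_smul_of_mdist_lt (Γ := Γ) (x := y) (y := z)
    (lt_add_of_pos_right _ (half_pos hδ))
  have hmk : (Quotient.mk _ (k • g • x) : Mfd Γ) = Quotient.mk _ x :=
    Quotient.sound ⟨k * g, mul_smul k g x⟩
  have h1 := mdist_mk_le (Γ := Γ) (k • g • x) z
  have h2 := hdist_triangle (k • g • x) (k • y) z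
  rw [hmk] at h1
  rw [hdist_smul'] at h2
  linarith

lemma geodFlow_geodFlow (s t : ℝ) (v : SMfd Γ) :
    geodFlow s (geodFlow t v) = geodFlow (s + t) v := by
  induction v using Quotient.inductionOn with | h v =>
  exact congrArg (Quotient.mk _) (flow_flow s t v)

lemma geodFlow_zero (v : SMfd Γ) : geodFlow 0 v = v := by
  induction v using Quotient.inductionOn with | h v =>
  exact congrArg (Quotient.mk _) (flow_zero v)

lemma geod_geodFlow (s t : ℝ) (v : SMfd Γ) : geod (geodFlow s v) t = geod v (s + t) := by
  rw [geod, geodFlow_geodFlow, add_comm, geod]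

lemma geod_mk (v : UnitTangent n) (t : ℝ) :
    geod (Quotient.mk _ v : SMfd Γ) t = Quotient.mk _ (foot (flow t v)) := rfl

lemma bowenDist_le_iff {l : ℝ} (hl : 0 ≤ l) (v w : SMfd Γ) (r : ℝ) :
    bowenDist l v w ≤ r ↔ ∀ t ∈ Set.Icc 0 l, mdist (geod v t) (geod w t) ≤ r := by
  have : Nonempty (Set.Icc 0 l) := ⟨⟨0, le_rfl, hl⟩⟩
  rw [bowenDist, ciSup_le_iff, Subtype.forall]
  induction v using Quotient.inductionOn with | h v =>
  induction w using Quotient.inductionOn with | h w =>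
  -- A real supremum is meaningful only for a bounded family; going back along both geodesics to the
  -- footpoints gives a bound.
  refine ⟨l + hdist (foot v) (foot w) + l, ?_⟩
  rintro _ ⟨⟨t, ht0, htl⟩, rfl⟩
  refine (mdist_mk_le (foot (flow t v)) (foot (flow t w))).trans ?_
  have h1 := hdist_triangle (foot (flow t v)) (foot v) (foot (flow t w))
  have h2 := hdist_triangle (foot v) (foot w) (foot (flow t w))
  rw [hdist_comm _ (foot v), hdist_foot_flow, abs_of_nonneg ht0] at h1
  rw [hdist_foot_flow, abs_of_nonneg ht0] at h2
  linarith

/-- Nontrivial elements of the lattice displace every point by at least the injectivity radius. -/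
lemma injRadius_le_hdist (hΓ : IsTorsionFreeCocompactLattice Γ) {g : Γ} (hg : g ≠ 1) (x : Hyp n) :
    injRadius Γ ≤ hdist x (g • x) := by
  by_contra! hlt
  obtain ⟨r, hr, hlt⟩ := exists_lt_of_lt_csSup
    (by
      refine ⟨0, fun v w _ t t' h1 h2 => ?_⟩
      exact absurd h2 (not_lt.2 h1)) hlt
  have hne : x ≠ g • x := fun h => hg (eq_one_of_smul_eq hΓ h.symm)
  obtain ⟨v, rfl, hv⟩ := exists_direction hne
  have hd := hdist_nonneg (foot v) (g • foot v)
  -- The geodesic from `x` to `g • x` closes up in the quotient, so the exponential map takes the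
  -- same value at radii `hdist x (g • x)` and `0`.
  have h := hr (Quotient.mk _ v) (Quotient.mk _ v) rfl _ 0 hd hlt le_rfl (hd.trans_lt hlt)
    (by
      rw [geod_mk, geod_mk, hv, flow_zero]
      exact Quotient.sound ⟨g, rfl⟩)
  exact hne (eq_of_hdist_eq_zero h.1)

lemma injRadius_le_period (hΓ : IsTorsionFreeCocompactLattice Γ) {w : SMfd Γ} {p : ℝ} (hp : 0 < p)
    (h : geodFlow p w = w) : injRadius Γ ≤ p := by
  induction w using Quotient.inductionOn with | h w =>
  obtain ⟨g, hg⟩ := Quotient.exact h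
  change g • w = flow p w at hg
  have hd : hdist (foot w) (g • foot w) = p := by
    have : g • foot w = foot (flow p w) := congrArg foot hg
    rw [this, hdist_foot_flow, abs_of_pos hp]
  rw [← hd]
  refine injRadius_le_hdist hΓ ?_ _
  rintro rfl
  rw [one_smul, hdist, (foot w).2.1, neg_neg, arcosh_zero] at hd
  exact hp.ne hd

/-- Every periodic vector has a primitive period. -/
lemma exists_isClosedGeodesic (hΓ : IsTorsionFreeCocompactLattice Γ) (hpos : 0 < injRadius Γ)
    {w : SMfd Γ} {p : ℝ} (hp : 0 < p) (h : geodFlow p w = w) :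
    ∃ ℓ ≤ p, IsClosedGeodesic w ℓ := by
  let H : AddSubgroup ℝ :=
    { carrier := {t | geodFlow t w = w}
      zero_mem' := geodFlow_zero w
      add_mem' := fun {s t} (hs : geodFlow s w = w) (ht : geodFlow t w = w) => by
        change geodFlow (s + t) w = w
        rw [← geodFlow_geodFlow, ht, hs]
      neg_mem' := fun {t} (ht : geodFlow t w = w) => by
        change geodFlow (-t) w = w
        conv_lhs => rw [← ht, geodFlow_geodFlow, neg_add_cancel, geodFlow_zero] }
  have hmem (t : ℝ) : t ∈ H ↔ geodFlow t w = w := Iff.rfl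
  -- No period lies strictly between `0` and the injectivity radius, so the group of periods has a
  -- least positive element.
  obtain ⟨ℓ, hℓ⟩ := AddSubgroup.exists_isLeast_pos (H := H)
    (fun hbot => hp.ne' ((AddSubgroup.mem_bot).1 (hbot ▸ (hmem p).2 h))) hpos
    (Set.disjoint_left.2 fun t ht ht' =>
      not_le.2 ht'.2 (injRadius_le_period hΓ ht'.1 ((hmem t).1 ht)))
  refine ⟨ℓ, hℓ.2 ⟨h, hp⟩, ?_⟩
  have hset : {p : ℝ | 0 < p ∧ geodFlow p w = w} = {g : ℝ | g ∈ H ∧ 0 < g} := by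
    ext t
    exact and_comm
  rwa [IsClosedGeodesic, hset]

lemma ofReal_le_penetration {ε₀ ℓ t₀ L : ℝ} {w v : SMfd Γ} (hℓ : 0 ≤ ℓ) (hL : 0 ≤ L)
    (h : ∀ t ∈ Set.Icc 0 L, mdist (geod v (t₀ + t)) (geod w t) ≤ ε₀ / 2) :
    ENNReal.ofReal L ≤ penetration ε₀ w ℓ v t₀ := by
  have hinf : ¬ ε₀ / 2 < ⨅ t : ℝ, mdist (geod v t₀) (geod w t) := by
    refine not_lt.2 ((ciInf_le ⟨0, ?_⟩ 0).trans (by simpa using h 0 ⟨le_rfl, hL⟩))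
    rintro _ ⟨t, rfl⟩
    exact mdist_nonneg _ _
  rw [penetration, if_neg hinf]
  refine le_sSup ⟨L, hL, rfl, 0, ⟨le_rfl, hℓ⟩, ?_⟩
  rw [bowenDist_le_iff hL]
  intro t ht
  rw [geod_geodFlow, geodFlow_zero]
  exact h t ht

/-- Two pieces of a geodesic that stay close in the quotient are matched by one lattice element. -/
lemma exists_matching_element (hΓ : IsTorsionFreeCocompactLattice Γ) {ε : ℝ}
    (hε : ε < injRadius Γ / 2) {l : ℝ} (hl : 0 ≤ l) {v w : UnitTangent n}
    (h : ∀ τ ∈ Set.Icc 0 l, mdist (geod (Quotient.mk _ v : SMfd Γ) τ)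
      (geod (Quotient.mk _ w : SMfd Γ) τ) ≤ ε) :
    ∃ η : Γ, ∀ τ ∈ Set.Icc 0 l, hdist (η • foot (flow τ v)) (foot (flow τ w)) ≤ ε := by
  -- Two elements bringing `x` close to the same `y` differ by one of displacement below the
  -- injectivity radius, hence agree. So the matching element is locally constant in `τ`.
  have huniq {g k : Γ} {x y : Hyp n} {r₁ r₂ : ℝ} (h1 : hdist (g • x) y < r₁)
      (h2 : hdist (k • x) y < r₂) (hr : r₁ + r₂ ≤ injRadius Γ) : g = k := by
    by_contra hne
    have hne' : k⁻¹ * g ≠ 1 := fun h => hne (inv_mul_eq_one.1 h).symm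
    have h3 := injRadius_le_hdist hΓ hne' x
    have h4 := hdist_triangle (k • x) y (g • x)
    rw [← hdist_smul' k, mul_smul, smul_inv_smul] at h3
    rw [hdist_comm y] at h4
    linarith
  obtain ⟨ε', hε1, hε2⟩ := exists_between hε
  have hex (τ : Set.Icc 0 l) : ∃ g : Γ, hdist (g • foot (flow τ v)) (foot (flow τ w)) < ε' :=
    exists_smul_of_mdist_lt ((h τ τ.2).trans_lt hε1)
  choose η hη using hex
  have hloc : IsLocallyConstant η := by
    rw [IsLocallyConstant.iff_eventually_eq]
    intro τ
    have hδ : 0 < (injRadius Γ - 2 * ε') / 2 := by linarith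
    filter_upwards [Metric.ball_mem_nhds τ hδ] with σ hσ
    have hσ : |(σ : ℝ) - τ| < (injRadius Γ - 2 * ε') / 2 := hσ
    refine huniq (hη σ) (r₂ := ε' + (injRadius Γ - 2 * ε')) ?_ (by linarith)
    have h1 := hdist_triangle (η τ • foot (flow σ v)) (η τ • foot (flow τ v)) (foot (flow σ w))
    have h2 := hdist_triangle (η τ • foot (flow τ v)) (foot (flow τ w)) (foot (flow σ w))
    rw [hdist_smul', hdist_flow_flow, abs_sub_comm] at h1
    rw [hdist_flow_flow] at h2
    linarith [hη τ]
  have : PreconnectedSpace (Set.Icc 0 l) := isPreconnected_iff_preconnectedSpace.1 isPreconnected_Icc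
  refine ⟨η ⟨0, le_rfl, hl⟩, fun τ hτ => ?_⟩
  rw [hloc.apply_eq_of_preconnectedSpace ⟨0, le_rfl, hl⟩ ⟨τ, hτ⟩]
  -- The distance in the quotient is an infimum, so lifts only achieve `< r` for `r > ε`; uniqueness
  -- makes the element independent of `r`.
  refine le_of_forall_gt_imp_ge_of_dense fun r hr => ?_
  obtain ⟨g, hg⟩ := exists_smul_of_mdist_lt (Γ := Γ)
    ((h τ hτ).trans_lt (lt_min hr hε1))
  have hgη : g = η ⟨τ, hτ⟩ := huniq (hg.trans_le (min_le_right _ _)) (hη ⟨τ, hτ⟩) (by linarith)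
  rw [← hgη]
  exact (hg.trans_le (min_le_left _ _)).le

/-- Aperiodic rays have bounded penetration lengths. -/
lemma boundedForAll_of_isAperiodicRay (hΓ : IsTorsionFreeCocompactLattice Γ) {ε₀ : ℝ}
    (hε₀ : 0 < ε₀) (hε₀' : ε₀ < injRadius Γ / 2) {φ : ℝ → ℝ} {v : SMfd Γ}
    (hmono : StrictMonoOn φ (Set.Ioi 1)) (hbij : Set.BijOn φ (Set.Ioi 1) (Set.Ioi ε₀))
    (hv : IsAperiodicRay ε₀ 0 φ v) : BoundedForAll ε₀ φ v := by
  intro w ℓ hw t₀ ht₀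
  have hℓ : ε₀ < ℓ := by linarith [injRadius_le_period hΓ hw.1.1 hw.1.2]
  have himg : ℓ ∈ φ '' Set.Ioi 1 := hbij.surjOn hℓ
  have hinv : φ (Function.invFunOn φ (Set.Ioi 1) ℓ) = ℓ := Function.invFunOn_eq himg
  have hone : 1 < Function.invFunOn φ (Set.Ioi 1) ℓ := Function.invFunOn_mem himg
  rw [penetration]
  split_ifs
  · exact zero_le
  refine sSup_le ?_
  rintro _ ⟨L, hL, rfl, t, ht, hd⟩
  refine ENNReal.ofReal_le_ofReal ?_
  by_contra! hlt
  have hdL := (bowenDist_le_iff hL _ _ _).1 hd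
  have hlen : 1 < L - ℓ := by linarith
  -- At times `τ` and `ℓ + τ` the ray is `ε₀ / 2`-close to the same point of the closed geodesic.
  have hclose : bowenDist (L - ℓ) (geodFlow t₀ v) (geodFlow (t₀ + ℓ) v) ≤ ε₀ := by
    rw [bowenDist_le_iff (by linarith)]
    intro τ hτ
    have h1 := hdL τ ⟨hτ.1, by linarith [hτ.2]⟩
    have h2 := hdL (ℓ + τ) ⟨by linarith [hτ.1], by linarith [hτ.2]⟩
    have hper : geod (geodFlow t w) (ℓ + τ) = geod (geodFlow t w) τ := by
      rw [geod_geodFlow, geod_geodFlow, show t + (ℓ + τ) = ℓ + (t + τ) by ring,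
        ← geod_geodFlow ℓ, hw.1.2]
    rw [hper, geod_geodFlow t₀ (ℓ + τ), ← add_assoc, ← geod_geodFlow (t₀ + ℓ), mdist_comm] at h2
    have := mdist_triangle (geod (geodFlow t₀ v) τ) (geod (geodFlow t w) τ)
      (geod (geodFlow (t₀ + ℓ) v) τ)
    linarith
  have h3 := hv t₀ ℓ (L - ℓ) ht₀ hℓ (by linarith) hlen hclose
  have h4 := hmono hone hlen (by linarith : Function.invFunOn φ (Set.Ioi 1) ℓ < L - ℓ)
  linarith

/-- A long self-approach of a geodesic comes from a closed geodesic it follows. -/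
lemma exists_closedGeodesic_follow (hΓ : IsTorsionFreeCocompactLattice Γ) {ε₀ : ℝ}
    (hε₀ : 0 < ε₀) (hε₀' : ε₀ < injRadius Γ / 2) {c₀ δ s l t₀ : ℝ}
    (hδ : δ = 4 * exp (2 * ε₀ - 2 * c₀)) (hδ1 : δ < 1) (hδε : (1 + δ) / (1 - δ) ≤ cosh (ε₀ / 2))
    (hs : ε₀ + 1 ≤ s) (hl : ε₀ + 1 ≤ l) (hc₀ : 2 * c₀ ≤ s + l) {v : SMfd Γ}
    (h : bowenDist l (geodFlow t₀ v) (geodFlow (t₀ + s) v) ≤ ε₀) :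
    ∃ (w : SMfd Γ) (ℓ : ℝ), IsClosedGeodesic w ℓ ∧ ℓ ≤ s + ε₀ ∧
      ENNReal.ofReal (s + l - 2 * c₀) ≤ penetration ε₀ w ℓ v (t₀ + c₀) := by
  induction v using Quotient.inductionOn with | h u =>
  have hl0 : 0 ≤ l := by linarith
  obtain ⟨η, hη⟩ := exists_matching_element hΓ hε₀' hl0 (v := flow t₀ u) (w := flow (t₀ + s) u)
    ((bowenDist_le_iff hl0 _ _ _).1 h)
  have hclose : ∀ τ ∈ Set.Icc 0 l,
      hdist (η • foot (flow τ (flow t₀ u))) (foot (flow (s + τ) (flow t₀ u))) ≤ ε₀ := by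
    intro τ hτ
    convert hη τ hτ using 3
    rw [flow_flow, flow_flow]
    congr 1
    ring
  have h0 := hclose 0 ⟨le_rfl, hl0⟩
  rw [flow_zero, add_zero] at h0
  have hdist0 : hdist (foot (flow t₀ u)) (foot (flow s (flow t₀ u))) = s := by
    rw [hdist_foot_flow, abs_of_nonneg (by linarith)]
  have hη1 : η ≠ 1 := by
    rintro rfl
    rw [one_smul, hdist0] at h0
    linarith
  obtain ⟨w, p, hp, hw, hmin⟩ := exists_axis hΓ hη1
  have hps : p ≤ s + ε₀ := by
    have h1 := hmin (foot (flow t₀ u))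
    have h2 := hdist_triangle (foot (flow t₀ u)) (foot (flow s (flow t₀ u)))
      (η • foot (flow t₀ u))
    rw [hdist_comm (foot (flow s (flow t₀ u))), hdist0] at h2
    linarith
  obtain ⟨κ, hκ⟩ := exists_shift_close (η := η.1) hε₀ hs hl hp.le hc₀ hδ hδ1 hδε hw hclose
  -- The axis vector is rebased at time `c₀ + κ`, so that following starts at parameter `0` of the
  -- closed geodesic.
  have hper : geodFlow p (Quotient.mk _ (flow (c₀ + κ) w) : SMfd Γ) =
      Quotient.mk _ (flow (c₀ + κ) w) := by
    refine Quotient.sound ⟨η, ?_⟩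
    change η.1 • flow (c₀ + κ) w = flow p (flow (c₀ + κ) w)
    rw [← flow_smul, show η.1 • w = flow p w from hw, flow_flow, flow_flow, add_comm]
  obtain ⟨ℓ, hℓp, hℓ⟩ := exists_isClosedGeodesic hΓ (by linarith) hp hper
  refine ⟨_, ℓ, hℓ, hℓp.trans hps, ofReal_le_penetration hℓ.1.1.le (by linarith) ?_⟩
  intro t ht
  refine (mdist_mk_le (foot (flow (t₀ + c₀ + t) u)) (foot (flow t (flow (c₀ + κ) w)))).trans ?_
  have h1 := hκ (c₀ + t) ⟨by linarith [ht.1], by linarith [ht.2]⟩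
  rwa [flow_flow, show c₀ + t + t₀ = t₀ + c₀ + t by ring,
    show c₀ + t + κ = t + (c₀ + κ) by ring, ← flow_flow t] at h1

end HypGeod

end

theorem mainTheorem5 (n : ℕ) (Γ : Subgroup (HypGeod.IsomHyp n))
    (hΓ : HypGeod.IsTorsionFreeCocompactLattice Γ)
    (ε₀ : ℝ) (hε₀ : 0 < ε₀) (hε₀' : ε₀ < HypGeod.injRadius Γ / 2) :
    (∀ (φ : ℝ → ℝ) (v : HypGeod.SMfd Γ),
      StrictMonoOn φ (Set.Ioi 1) → Set.BijOn φ (Set.Ioi 1) (Set.Ioi ε₀) →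
      HypGeod.IsAperiodicRay ε₀ 0 φ v → HypGeod.BoundedForAll ε₀ φ v) ∧
    (2 * Real.log (1 + √2) ≤ HypGeod.injRadius Γ →
      ∃ c₀ l₀ s₀ : ℝ, 0 < c₀ ∧ 2 * c₀ + 2 * ε₀ + 1 < l₀ ∧ ε₀ < s₀ ∧
        ∀ (φ : ℝ → ℝ) (v : HypGeod.SMfd Γ),
          StrictMonoOn φ (Set.Ioi 1) → Set.BijOn φ (Set.Ioi 1) (Set.Ioi ε₀) →
          HypGeod.BoundedForAll ε₀ φ v →
          ∀ t₀ s l : ℝ, 0 ≤ t₀ → s₀ ≤ s → l₀ ≤ l →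
            HypGeod.bowenDist l (HypGeod.geodFlow t₀ v) (HypGeod.geodFlow (t₀ + s) v) ≤ ε₀ →
            φ (l - 2 * c₀ - 2 * ε₀) - ε₀ ≤ s) := by
  refine ⟨fun φ v hmono hbij hv =>
    HypGeod.boundedForAll_of_isAperiodicRay hΓ hε₀ hε₀' hmono hbij hv, fun _ => ?_⟩
  have hC : 1 < Real.cosh (ε₀ / 2) := Real.one_lt_cosh.2 (by positivity)
  obtain ⟨C, hCdef⟩ : ∃ C, C = Real.cosh (ε₀ / 2) := ⟨_, rfl⟩
  rw [← hCdef] at hC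
  -- This `δ` solves `(1 + δ) / (1 - δ) = cosh (ε₀ / 2)`, and `c₀` below solves `δ = 4 exp (2ε₀ -
  -- 2c₀)`.
  obtain ⟨δ, hδ⟩ : ∃ δ, δ = (C - 1) / (C + 1) := ⟨_, rfl⟩
  have hδ0 : 0 < δ := by rw [hδ]; exact div_pos (by linarith) (by linarith)
  have hδ1 : δ < 1 := by rw [hδ, div_lt_one (by linarith)]; linarith
  have hδC : (1 + δ) / (1 - δ) ≤ Real.cosh (ε₀ / 2) := by
    rw [← hCdef, div_le_iff₀ (by linarith), hδ]
    field_simp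
    linarith
  have hlog : Real.log (δ / 4) < 0 := Real.log_neg (by positivity) (by linarith)
  obtain ⟨c₀, hc₀⟩ : ∃ c₀, c₀ = ε₀ - Real.log (δ / 4) / 2 := ⟨_, rfl⟩
  have hδexp : δ = 4 * Real.exp (2 * ε₀ - 2 * c₀) := by
    rw [hc₀, show 2 * ε₀ - 2 * (ε₀ - Real.log (δ / 4) / 2) = Real.log (δ / 4) by ring,
      Real.exp_log (by positivity)]
    ring
  refine ⟨c₀, 2 * c₀ + 2 * ε₀ + 2, ε₀ + 1, by linarith, by linarith, by linarith, ?_⟩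
  intro φ v hmono hbij hv t₀ s l ht₀ hs hl hd
  obtain ⟨w, ℓ, hw, hℓs, hpen⟩ := HypGeod.exists_closedGeodesic_follow hΓ hε₀ hε₀' hδexp hδ1 hδC hs
    (by linarith) (by linarith) hd
  have hℓ : ε₀ < ℓ := by linarith [HypGeod.injRadius_le_period hΓ hw.1.1 hw.1.2]
  have himg : ℓ ∈ φ '' Set.Ioi 1 := hbij.surjOn hℓ
  have hinv : φ (Function.invFunOn φ (Set.Ioi 1) ℓ) = ℓ := Function.invFunOn_eq himg
  have hone : 1 < Function.invFunOn φ (Set.Ioi 1) ℓ := Function.invFunOn_mem himg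
  have hle := hpen.trans (hv w ℓ hw (t₀ + c₀) (by linarith))
  rw [ENNReal.ofReal_le_ofReal_iff (by linarith)] at hle
  -- From `s + l - 2c₀ ≤ ℓ + φ⁻¹(ℓ)` and `ℓ ≤ s + ε₀` follows `l - 2c₀ - 2ε₀ ≤ φ⁻¹(ℓ)`; the choice
  -- of `l₀` keeps the left side above `1`.
  have := hmono.monotoneOn (a := l - 2 * c₀ - 2 * ε₀)
    (Set.mem_Ioi.2 (by linarith)) hone (by linarith)
  linarith
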